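/- Let $K$ be an algebraically closed field of characteristic zero, and let $\mathcal F_i$ be the space of forms of degree $i$ in $K[x_0,x_1,x_2,x_3]$. Let $\mathbb X\subset\mathbb G(3,\mathcal F_2)$ be the variety of determinantal nets of quadrics in $\mathbb P^3$, i.e. the three-dimensional spaces of quadratic forms spanned by the $2\times2$ minors of a $3\times 2$ matrix of linear forms. Let $\mathbb G\subset\mathbb X$ be the subvariety of the nets $(L)^2=\langle H^2,HH',H'^2\rangle$, where $L=\{H=H'=0\}$ runs over the lines of $\mathbb P^3$. Let $\widehat{\mathbb X}\to\mathbb X$ be the blow-up of $\mathbb X$ along $\mathbb G$, and $\widehat{\mathbb E}\subset\widehat{\mathbb X}$ the exceptional divisor. (Concretely: if $f_1,\dots,f_m$ are forms of the same degree in the Plücker coordinates that vanish on $\mathbb G$ and generate the ideal sheaf of $\mathbb G$ in $\mathbb X$, then $\widehat{\mathbb X}$ is the closure in $\mathbb X\times\mathbb P^{m-1}$ of the graph of $[f_1:\dots:f_m]:\mathbb X\setminus\mathbb G\to\mathbb P^{m-1}$, and $\widehat{\mathbb E}$ is the inverse image of $\mathbb G$.) There is a unique rank six subbundle $\mathcal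 Q$ of the trivial bundle $\widehat{\mathbb X}\times\mathcal F_4$ whose fibre over each net $\pi\in\mathbb X\setminus\mathbb G$ is $\pi^2$, the span of the products of two elements of $\pi$; it is called the bundle of quartic forms. For a line $L$ with ideal $(L)=(H,H')$ let $\mathcal F_i^{(L)^i}$ be the space of forms of degree $i$ in $(L)^i$, and put $V_L=\mathcal F_3^{(L)^3}\cdot\mathcal F_1/\mathcal F_4^{(L)^4}$. Then, for every line $L$: 1. For every $\widehat e\in\widehat{\mathbb E}$ over $e=(L)^2\in\mathbb G$ there is a unique $[Q]\in\mathbb P(V_L)$ with $\mathcal Q_{\widehat e}=\mathcal F_4^{(L)^4}+\langle Q\rangle$. 2. The map $\widehat e\mapsto[Q]$ identifies the fibre $\widehat{\mathbb E}_e$ of $\widehat{\mathbb E}$ over $e$ with the projective space $\mathbb P(V_L)$: there is an injective linear map $\psi:V_L\to K^m$ such that $\widehat{\mathbb E}_e=\{e\}\times\mathbb P(\psi(V_L))$, and the fibre of $\mathcal Q$ at $(e,[\psi(Q)])$ is $\mathcal F_4^{(L)^4}+\langle Q\rangle$ for every $[Q]\in\mathbb P(V_L)$. -/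

import Mathlib

open MvPolynomial Module
open scoped LinearAlgebra.Projectivization

namespace DetNets

/-- Quadratic monomials (as exponent vectors) in the four homogeneous coordinates of `ℙ³`. -/
abbrev QuadMon : Type := {m : Fin 4 →₀ ℕ // m.degree = 2}

/-- Indices of the Plücker coordinates on the Grassmannian of nets of quadrics
(all triples of quadratic monomials; the coordinates are alternating in the triple). -/
abbrev PIdx : Type := Fin 3 → QuadMon

section

variable (K : Type*) [Field K]

/-- The homogeneous coordinate ring `K[x₀, x₁, x₂, x₃]` of `ℙ³`. -/
abbrev Poly : Type _ := MvPolynomial (Fin 4) K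

/-- The space `F_i` of forms of degree `i` on `ℙ³`. -/
noncomputable abbrev Forms (i : ℕ) : Submodule K (Poly K) :=
  homogeneousSubmodule (Fin 4) K i

variable {K}

/-- The three `2 × 2` minors of a `3 × 2` matrix: the `i`-th one omits the row `i`. -/
noncomputable def minors (A : Matrix (Fin 3) (Fin 2) (Poly K)) (i : Fin 3) : Poly K :=
  (A.submatrix i.succAbove id).det

variable (K) in
/-- The variety `𝕏` of determinantal nets of quadrics: three-dimensional spaces of quadratic
forms spanned by the `2 × 2` minors of a `3 × 2` matrix of linear forms. -/
def detNets : Set (Submodule K (Poly K)) :=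
  {π | finrank K π = 3 ∧ ∃ A : Matrix (Fin 3) (Fin 2) (Poly K),
    (∀ i j, A i j ∈ Forms K 1) ∧ π = Submodule.span K (Set.range (minors A))}

/-- A line in `ℙ³`, given by the two-dimensional space `Λ = ⟨H, H'⟩` of linear forms vanishing
on it. -/
def IsLine (Λ : Submodule K (Poly K)) : Prop :=
  Λ ≤ Forms K 1 ∧ finrank K Λ = 2

variable (K) in
/-- The subvariety `𝔾 ⊆ 𝕏` of the nets `(L)² = ⟨H², H H', H'²⟩`, where `L` is a line. -/
def squareNets : Set (Submodule K (Poly K)) :=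
  {π | ∃ Λ : Submodule K (Poly K), IsLine Λ ∧ π = Λ ^ 2}

/-- The space `F_i^{(L)^j}` of forms of degree `i` in the `j`-th power of the ideal of the line. -/
noncomputable def formsOn (Λ : Submodule K (Poly K)) (i j : ℕ) : Submodule K (Poly K) :=
  Forms K i ⊓ (Ideal.span (Λ : Set (Poly K)) ^ j).restrictScalars K

/-- The space `F_3^{(L)^3} · F_1`. -/
noncomputable def cubicTimesLinear (Λ : Submodule K (Poly K)) : Submodule K (Poly K) :=
  formsOn Λ 3 3 * Forms K 1

/-- The vector space `F_3^{(L)^3} · F_1 / F_4^{(L)^4}`. -/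
abbrev QuarticQuot (Λ : Submodule K (Poly K)) : Type _ :=
  ↥(cubicTimesLinear Λ) ⧸ (formsOn Λ 4 4).submoduleOf (cubicTimesLinear Λ)

/-- The space of quartic forms `F_4^{(L)^4} + ⟨Q⟩` attached to a point
`ℓ = [Q]` of `ℙ(F_3^{(L)^3} · F_1 / F_4^{(L)^4})`:
all the forms of `F_3^{(L)^3} · F_1` with class in the line `ℓ`, together with `F_4^{(L)^4}`. -/
noncomputable def quarticSpace (Λ : Submodule K (Poly K)) (ℓ : ℙ K (QuarticQuot Λ)) :
    Submodule K (Poly K) :=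
  formsOn Λ 4 4 ⊔ (ℓ.submodule.comap
    ((formsOn Λ 4 4).submoduleOf (cubicTimesLinear Λ)).mkQ).map (cubicTimesLinear Λ).subtype

/-- Explicitly, `[Q]` gives `F_4^{(L)^4} + ⟨Q⟩`. -/
theorem quarticSpace_mk (Λ : Submodule K (Poly K)) (Q : cubicTimesLinear Λ)
    (hQ : ((formsOn Λ 4 4).submoduleOf (cubicTimesLinear Λ)).mkQ Q ≠ 0) :
    quarticSpace Λ (Projectivization.mk K _ hQ) =
      formsOn Λ 4 4 ⊔ Submodule.span K {(Q : Poly K)} := by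
  unfold quarticSpace
  rw [Projectivization.submodule_mk]
  apply le_antisymm
  · refine sup_le le_sup_left ?_
    rintro _ ⟨y, hy, rfl⟩
    obtain ⟨c, hc⟩ := Submodule.mem_span_singleton.1 hy
    rw [← map_smul, ← sub_eq_zero, ← map_sub, ← LinearMap.mem_ker, Submodule.ker_mkQ] at hc
    have h1 : (c • Q - y : Poly K) ∈ formsOn Λ 4 4 := hc
    have h2 : (y : Poly K) = -(c • Q - y : Poly K) + c • (Q : Poly K) := by abel
    change (y : Poly K) ∈ _
    rw [h2]
    exact Submodule.add_mem_sup (neg_mem h1)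
      (Submodule.smul_mem _ _ (Submodule.mem_span_singleton_self _))
  · refine sup_le le_sup_left (le_trans ?_ le_sup_right)
    rw [Submodule.span_singleton_le_iff_mem]
    exact ⟨Q, Submodule.mem_span_singleton_self _, rfl⟩

/-! ### Coordinates, ideals and the blow-up -/

/-- The Plücker coordinates of the net with basis `q`: the `3 × 3` minors of the matrix of
coefficients. -/
noncomputable def plucker (q : Fin 3 → Poly K) (s : PIdx) : K :=
  (Matrix.of fun i j : Fin 3 => coeff (s j).1 (q i)).det

/-- `p` is a vector of Plücker coordinates of the net `π` (such a `p` is unique up to a nonzero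
scalar factor, and every such factor occurs). -/
def IsPlucker (π : Submodule K (Poly K)) (p : PIdx → K) : Prop :=
  ∃ q : Fin 3 → Poly K, LinearIndependent K q ∧ Submodule.span K (Set.range q) = π ∧ p = plucker q

/-- The (homogeneous) ideal of a set of nets in the Plücker coordinate ring. -/
noncomputable def netIdeal (A : Set (Submodule K (Poly K))) : Ideal (MvPolynomial PIdx K) :=
  vanishingIdeal K {p | ∃ π ∈ A, IsPlucker π p}

/-- `f` is a system of forms of the same degree `d` in the Plücker coordinates, vanishing on `𝔾`,
that generates the ideal sheaf of `𝔾` in `𝕏`: up to saturation, and modulo the ideal of `𝕏`,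
the `f i` generate the homogeneous ideal of `𝔾`. -/
structure IsBlowupSystem {m : ℕ} (d : ℕ) (f : Fin m → MvPolynomial PIdx K) : Prop where
  homogeneous : ∀ i, (f i).IsHomogeneous d
  vanishes : ∀ i, f i ∈ netIdeal (squareNets K)
  generates : ∃ N : ℕ, netIdeal (squareNets K) * idealOfVars PIdx K ^ N ≤
    Ideal.span (Set.range f) ⊔ netIdeal (detNets K)

/-- The points (net, point of `ℙ^{m-1}`). -/
abbrev Pt (K : Type*) [Field K] (m : ℕ) : Type _ :=
  Submodule K (Poly K) × ℙ K (Fin m → K)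

/-- `c` is a vector of bihomogeneous coordinates of the point `z`. All the rescalings of the two
blocks of coordinates are allowed. -/
def IsCoord {m : ℕ} (z : Pt K m) (c : PIdx ⊕ Fin m → K) : Prop :=
  IsPlucker z.1 (fun s => c (Sum.inl s)) ∧
    ∃ h : (fun i => c (Sum.inr i)) ≠ 0, z.2 = Projectivization.mk K (fun i => c (Sum.inr i)) h

/-- The graph of the map `𝕏 ∖ 𝔾 → ℙ^{m-1}`, `π ↦ [f_1(π) : ⋯ : f_m(π)]`. -/
def graph {m : ℕ} (f : Fin m → MvPolynomial PIdx K) : Set (Pt K m) :=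
  {z | z.1 ∈ detNets K ∧ z.1 ∉ squareNets K ∧ ∃ p, IsPlucker z.1 p ∧
    ∃ h : (fun i => eval p (f i)) ≠ 0, z.2 = Projectivization.mk K (fun i => eval p (f i)) h}

/-- The blow-up `𝕏̂` of `𝕏` along `𝔾`: the Zariski closure in `𝕏 × ℙ^{m-1}` of the graph of
`[f_1 : ⋯ : f_m]`, for a system `f` of generators of the ideal sheaf of `𝔾`.
(As sets of coordinate vectors are stable under rescaling, it does not matter whether all
polynomials or only the bihomogeneous ones are used.) -/
def blowup {m : ℕ} (f : Fin m → MvPolynomial PIdx K) : Set (Pt K m) :=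
  {z | z.1 ∈ detNets K ∧ ∀ G : MvPolynomial (PIdx ⊕ Fin m) K,
    (∀ w ∈ graph f, ∀ c, IsCoord w c → eval c G = 0) → ∀ c, IsCoord z c → eval c G = 0}

/-- The exceptional divisor `Ê`: the inverse image of `𝔾` in the blow-up. -/
def exceptionalDivisor {m : ℕ} (f : Fin m → MvPolynomial PIdx K) : Set (Pt K m) :=
  {z | z ∈ blowup f ∧ z.1 ∈ squareNets K}

/-- A family `Q` of spaces of quartic forms, parametrised by the blow-up, is an algebraic subbundle
of rank `r` of the trivial bundle with fibre `F_4` (that is, the pullback of the tautological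
subbundle under a morphism from the blow-up to the Grassmannian of `r`-dimensional spaces of quartic
forms): each fibre has dimension `r`, and near each point (where some polynomial `h` in the
coordinates does not vanish) the fibres are spanned by the values of `r` quartic forms whose
coefficients are polynomials in the coordinates of the base. -/
def IsSubbundle {m : ℕ} (f : Fin m → MvPolynomial PIdx K) (r : ℕ)
    (Q : blowup f → Submodule K (Poly K)) : Prop :=
  (∀ z, Q z ≤ Forms K 4 ∧ finrank K (Q z) = r) ∧
  ∀ z₀ : blowup f, ∀ c₀, IsCoord z₀.1 c₀ →
    ∃ (h : MvPolynomial (PIdx ⊕ Fin m) K)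
      (s : Fin r → MvPolynomial (Fin 4) (MvPolynomial (PIdx ⊕ Fin m) K)),
      eval c₀ h ≠ 0 ∧ ∀ z : blowup f, ∀ c, IsCoord z.1 c → eval c h ≠ 0 →
        Q z = Submodule.span K (Set.range fun i => MvPolynomial.map (eval c) (s i))

/-- `Q` is the bundle of quartic forms on the blow-up: the rank six subbundle of the trivial
bundle with fibre `F_4` whose fibre over a net `π ∈ 𝕏 ∖ 𝔾` is `π²`, the image of the
multiplication map `S²π → F_4`. -/
def IsQuarticBundle {m : ℕ} (f : Fin m → MvPolynomial PIdx K)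
    (Q : blowup f → Submodule K (Poly K)) : Prop :=
  IsSubbundle f 6 Q ∧ ∀ z : blowup f, z.1.1 ∉ squareNets K → Q z = z.1.1 ^ 2


/-! ### Existence of systems of generators -/

theorem isPlucker_smul {π : Submodule K (Poly K)} {p : PIdx → K} (hp : IsPlucker π p)
    {t : K} (ht : t ≠ 0) : IsPlucker π (t • p) := by
  obtain ⟨q, hq, rfl, rfl⟩ := hp
  let w : Fin 3 → Kˣ := Function.update 1 0 (Units.mk0 t ht)
  refine ⟨w • q, hq.units_smul w, ?_, ?_⟩
  · apply le_antisymm <;> rw [Submodule.span_le] <;> rintro _ ⟨i, rfl⟩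
    · exact Submodule.smul_mem _ (w i : K) (Submodule.subset_span ⟨i, rfl⟩)
    · have h : q i = ((w i)⁻¹ : Kˣ) • (w • q) i := by simp
      rw [h]
      exact Submodule.smul_mem _ (((w i)⁻¹ : Kˣ) : K) (Submodule.subset_span ⟨i, rfl⟩)
  · funext s
    have h : (Matrix.of fun i j : Fin 3 => coeff (s j).1 ((w • q) i)) =
        Matrix.of fun i j => (w i : K) * (Matrix.of fun i j : Fin 3 => coeff (s j).1 (q i)) i j := by
      ext i j
      simp [Units.smul_def]
    simp only [plucker, Pi.smul_apply, smul_eq_mul]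
    rw [h, Matrix.det_mul_column]
    simp [w, Fin.prod_univ_three]

theorem homogeneousComponent_mem_netIdeal [Infinite K] (A : Set (Submodule K (Poly K)))
    {F : MvPolynomial PIdx K} (hF : F ∈ netIdeal A) (i : ℕ) :
    homogeneousComponent i F ∈ netIdeal A := by
  rintro p ⟨π, hπ, hp⟩
  let P : Polynomial K := ∑ j ∈ Finset.range (F.totalDegree + 1),
    Polynomial.C (eval p (homogeneousComponent j F)) * Polynomial.X ^ j
  have hP : P = 0 := by
    refine Polynomial.eq_zero_of_infinite_isRoot _ (Set.Infinite.mono ?_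
      (Set.Finite.infinite_compl (Set.finite_singleton (0 : K))))
    intro t ht
    have ht : t ≠ 0 := ht
    have h1 : eval (t • p) F = 0 := hF _ ⟨π, hπ, isPlucker_smul hp ht⟩
    rw [← sum_homogeneousComponent F, map_sum] at h1
    change Polynomial.eval t P = 0
    rw [Polynomial.eval_finsetSum, ← h1]
    refine Finset.sum_congr rfl fun j _ => ?_
    have hj := homogeneousComponent_isHomogeneous j F
    generalize homogeneousComponent j F = G at hj
    simp only [Polynomial.eval_mul, Polynomial.eval_C, Polynomial.eval_pow, Polynomial.eval_X]
    rw [eval_eq, eval_eq, Finset.sum_mul]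
    refine Finset.sum_congr rfl fun e he => ?_
    have hd : ∑ x ∈ e.support, e x = j := by
      have := hj (mem_support_iff.1 he)
      rw [← this]; simp [Finsupp.weight_apply, Finsupp.sum]
    simp only [Pi.smul_apply, smul_eq_mul, mul_pow, Finset.prod_mul_distrib,
      Finset.prod_pow_eq_pow_sum, hd]
    ring
  by_cases hi : i < F.totalDegree + 1
  · have := congrArg (Polynomial.coeff · i) hP
    simpa [P, Polynomial.finsetSum_coeff, Polynomial.coeff_X_pow, hi] using this
  · rw [homogeneousComponent_eq_zero _ _ (by omega)]
    simp

instance : Finite QuadMon := by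
  refine Set.Finite.to_subtype (s := {m : Fin 4 →₀ ℕ | m.degree = 2}) ?_
  refine (Set.finite_Iic (Finsupp.equivFunOnFinite.symm fun _ : Fin 4 => 2)).subset ?_
  intro m hm i
  have hm : m.degree = 2 := hm
  simpa [← hm] using Finsupp.le_degree i m

/-- The blow-up exists: `𝔾` has systems of generators as above. -/
theorem exists_isBlowupSystem [Infinite K] :
    ∃ (m d : ℕ) (f : Fin m → MvPolynomial PIdx K), IsBlowupSystem d f := by
  classical
  obtain ⟨S, hS⟩ := (isNoetherianRing_iff_ideal_fg _).1
    (inferInstance : IsNoetherianRing (MvPolynomial PIdx K)) (netIdeal (squareNets K))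
  have hSI : ∀ g ∈ S, g ∈ netIdeal (squareNets K) := fun g hg => hS ▸ Ideal.subset_span hg
  let D := S.sup totalDegree
  let B : Set (PIdx →₀ ℕ) := {α | α.degree ≤ D}
  have hB : B.Finite := by
    refine (Set.finite_Iic (Finsupp.equivFunOnFinite.symm fun _ : PIdx => D)).subset ?_
    intro α hα i
    exact (Finsupp.le_degree i α).trans hα
  let U : Set (MvPolynomial PIdx K) :=
    {F | ∃ g ∈ S, ∃ i ≤ D, ∃ α : PIdx →₀ ℕ, α.degree = D - i ∧
      F = homogeneousComponent i g * monomial α 1}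
  have hU : U.Finite := by
    refine ((S.finite_toSet.prod ((Set.finite_Iic D).prod hB)).image
      fun x => homogeneousComponent x.2.1 x.1 * monomial x.2.2 (1 : K)).subset ?_
    rintro _ ⟨g, hg, i, hi, α, hα, rfl⟩
    exact ⟨(g, i, α), ⟨hg, hi, show α.degree ≤ D by omega⟩, rfl⟩
  obtain ⟨m, f, -, hf⟩ := hU.fin_param
  refine ⟨m, D, f, fun k => ?_, fun k => ?_, D, le_trans ?_ le_sup_left⟩
  · obtain ⟨g, hg, i, hi, α, hα, h⟩ : f k ∈ U := hf ▸ ⟨k, rfl⟩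
    rw [h]
    have := (homogeneousComponent_isHomogeneous i g).mul (isHomogeneous_monomial (1 : K) hα)
    rwa [Nat.add_sub_cancel' hi] at this
  · obtain ⟨g, hg, i, hi, α, hα, h⟩ : f k ∈ U := hf ▸ ⟨k, rfl⟩
    rw [h]
    exact Ideal.mul_mem_right _ _ (homogeneousComponent_mem_netIdeal _ (hSI g hg) i)
  · rw [hf, Ideal.mul_le, ← hS]
    intro a ha b hb
    induction ha using Submodule.span_induction with
    | zero => simp
    | add x y _ _ hx hy => rw [add_mul]; exact add_mem hx hy
    | smul c x _ hx => rw [smul_mul_assoc]; exact Submodule.smul_mem _ c hx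
    | mem g hg =>
      rw [← sum_homogeneousComponent g, Finset.sum_mul]
      refine sum_mem fun i hi => ?_
      have hiD : i ≤ D :=
        (Nat.lt_succ_iff.1 (Finset.mem_range.1 hi)).trans (Finset.le_sup (f := totalDegree) hg)
      have hb' : b ∈ idealOfVars PIdx K ^ (D - i) := Ideal.pow_le_pow_right (by omega) hb
      rw [pow_idealOfVars_eq_span] at hb'
      clear hb
      induction hb' using Submodule.span_induction with
      | zero => simp
      | add x y _ _ hx hy => rw [mul_add]; exact add_mem hx hy
      | smul c x _ hx => rw [mul_smul_comm]; exact Submodule.smul_mem _ c hx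
      | mem x hx =>
        obtain ⟨α, hα, rfl⟩ := hx
        exact Ideal.subset_span ⟨g, hg, i, hiD, α, hα, rfl⟩
end

end DetNets

/-! Away from `𝔾` the six products of a basis of a net `π` are independent. A relation among them is
a conic equation on the net. Over an algebraically closed field of characteristic zero it can be
diagonalised and must have rank three, because the polynomial ring is a domain; so it becomes `A *
C' = B ^ 2`. Unique factorisation and a degree count then force `A = a ^ 2`, `B = a * c`, `C' = c ^
2`, so the net is a square (`finrank_sq_eq`).

Near `𝔾` the variety is an affine space with coordinates `(u, w)`. The four `u` describe a line `H =
H' = 0`, and the eight `w` are the coefficients of linear forms `P 0, …, P 3` in the two remaining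
variables. The nets are the minors of a `3 × 2` matrix built from these forms (`exists_chart`), and
`𝔾` is `w = 0`. Hence in a chart the `f i` and the `w k` generate the same ideal
(`IsBlowupSystem.exists_normalPresentation`), and the fibre of the blow-up over `u` is the
projective space of normal directions `w`, embedded by the linear part of `f` (`mem_range`,
`mem_blowup`).

The quartics come from the identity `q₀ q₂ - q₁² = ∑ P k * R k` with cubic forms `R k`
(`quads_relation`). Its left side lies in `π²`. Along `t ↦ (u, t w)` it is divisible by `t`, and the
quotient tends to `normalQuartic σ u w`. At `w = 0` the `R k` are, up to sign, the four cubic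
monomials in `H, H'`, so `normalQuartic` maps the normal space isomorphically onto `Λ³ F₁ / Λ⁴`
(`normalClass_bijective`).

The bundle is built as the span of the values of all polynomial families of quartics that lie in
`π²` over the graph (`limitBundle`). Linear dependence is a closed condition, so these spans have
dimension at most six. They contain the square of the net and, over `𝔾`, also the limit quartic, so
the dimension is exactly six and the fibre is `Λ⁴ + ⟨normalQuartic σ u w⟩`. The same closedness
gives uniqueness of the bundle (`IsQuarticBundle.unique`). -/

namespace DetNets

/-! ### Polynomial families of vectors, determinants and curves -/

section LinearAlgebra

variable {K : Type*} [Field K]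

theorem exists_eval_eq_functional {ι : Type*} (φ : Poly K →ₗ[K] K)
    (s : MvPolynomial (Fin 4) (MvPolynomial ι K)) :
    ∃ G : MvPolynomial ι K, ∀ c, eval c G = φ (MvPolynomial.map (eval c) s) := by
  induction s using MvPolynomial.induction_on' with
  | monomial m a =>
    refine ⟨C (φ (monomial m 1)) * a, fun c => ?_⟩
    rw [map_monomial, map_mul, eval_C, mul_comm, ← smul_eq_mul, ← map_smul, smul_monomial,
      smul_eq_mul, mul_one]
  | add p q hp hq =>
    obtain ⟨G, hG⟩ := hp
    obtain ⟨G', hG'⟩ := hq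
    exact ⟨G + G', fun c => by rw [map_add, map_add, map_add, hG, hG']⟩

/-- Together with the next two lemmas this makes dependence of a polynomial family of vectors a
closed condition, tested by determinants of linear functionals. -/
theorem exists_eval_eq_det {ι : Type*} {n : ℕ} (φ : Fin n → Poly K →ₗ[K] K)
    (s : Fin n → MvPolynomial (Fin 4) (MvPolynomial ι K)) :
    ∃ G : MvPolynomial ι K, ∀ c,
      eval c G = (Matrix.of fun i j => φ i (MvPolynomial.map (eval c) (s j))).det := by
  choose g hg using fun i j => exists_eval_eq_functional (φ i) (s j)
  refine ⟨(Matrix.of g).det, fun c => ?_⟩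
  rw [RingHom.map_det]
  congr 1
  ext i j
  exact hg i j c

theorem exists_functionals_det_ne_zero {V : Type*} [AddCommGroup V] [Module K V] {n : ℕ}
    {v : Fin n → V} (hv : LinearIndependent K v) :
    ∃ φ : Fin n → V →ₗ[K] K, (Matrix.of fun i j => φ i (v j)).det ≠ 0 := by
  obtain ⟨g, hg⟩ := LinearMap.exists_leftInverse_of_injective
    (Fintype.linearCombination K v) (LinearMap.ker_eq_bot.2
      (linearIndependent_iff_injective_fintypeLinearCombination.1 hv))
  refine ⟨fun i => LinearMap.proj i ∘ₗ g, ?_⟩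
  have : (Matrix.of fun i j => (LinearMap.proj i ∘ₗ g : V →ₗ[K] K) (v j)) =
      (1 : Matrix (Fin n) (Fin n) K) := by
    ext i j
    have h := LinearMap.congr_fun hg (Pi.single j 1)
    simp only [LinearMap.comp_apply, Fintype.linearCombination_apply_single, one_smul,
      LinearMap.id_apply] at h
    simp [h, Matrix.one_apply, Pi.single_apply]
  rw [this]
  simp

theorem det_functionals_eq_zero {V : Type*} [AddCommGroup V] [Module K V] {n : ℕ}
    {v : Fin n → V} (hv : ¬ LinearIndependent K v) (φ : Fin n → V →ₗ[K] K) :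
    (Matrix.of fun i j => φ i (v j)).det = 0 := by
  obtain ⟨g, hg, i, hi⟩ := Fintype.not_linearIndependent_iff.1 hv
  rw [← Matrix.exists_mulVec_eq_zero_iff]
  refine ⟨g, fun h => hi (congrFun h i), ?_⟩
  ext k
  have := congrArg (φ k) hg
  simpa [Matrix.mulVec, dotProduct, mul_comm] using this

instance (i : ℕ) : Module.Finite K (Forms K i) :=
  Module.Finite.iff_fg.2 (homogeneousSubmodule_fg _ _ _)

theorem finrank_mono_of_le_forms {S T : Submodule K (Poly K)} (h : S ≤ T) {i : ℕ}
    (hT : T ≤ Forms K i) : finrank K S ≤ finrank K T := by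
  have : Module.Finite K T := Submodule.finiteDimensional_of_le hT
  exact Submodule.finrank_mono h

theorem eq_of_le_of_finrank_ge_of_le_forms {S T : Submodule K (Poly K)} (h : S ≤ T) {i : ℕ}
    (hT : T ≤ Forms K i) (hr : finrank K T ≤ finrank K S) : S = T := by
  have : Module.Finite K T := Submodule.finiteDimensional_of_le hT
  exact Submodule.eq_of_le_of_finrank_le h hr

/-- Algebraic substitute for a limit: `G` restricted to the curve is a polynomial in `t`, and its
product with `D` vanishes identically. -/
theorem eval_eq_zero_of_curve [Infinite K] {ι : Type*} (G : MvPolynomial ι K)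
    (c : ι → Polynomial K) {D : Polynomial K} (hD : D ≠ 0)
    (h : ∀ t, D.eval t ≠ 0 → eval (fun i => (c i).eval t) G = 0) (t : K) :
    eval (fun i => (c i).eval t) G = 0 := by
  have key : ∀ t, eval (fun i => (c i).eval t) G = (aeval c G).eval t := by
    intro t
    clear h
    induction G using MvPolynomial.induction_on with
    | C a => simp
    | add p q hp hq => simp_all
    | mul_X p i hp => simp_all
  have h0 : D * aeval c G = 0 := by
    refine Polynomial.funext fun t => ?_
    by_cases ht : D.eval t = 0
    · simp [ht]
    · simp [← key, h t ht]
  rw [key, (mul_eq_zero.1 h0).resolve_left hD, Polynomial.eval_zero]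

end LinearAlgebra

/-! ### Nets satisfying a quadratic relation are squares of lines -/

section Conic

variable {K : Type*} [Field K]

theorem range_vec_two {α : Type*} (a b : α) : Set.range ![a, b] = {a, b} := by
  ext x
  simp only [Set.mem_range, Fin.exists_fin_two, Set.mem_insert_iff, Set.mem_singleton_iff,
    Matrix.cons_val, eq_comm]

theorem range_vec_three {α : Type*} (a b c : α) : Set.range ![a, b, c] = {a, b, c} := by
  ext x
  rw [Set.mem_range, Fin.exists_fin_succ, Fin.exists_fin_two]
  simp only [Set.mem_insert_iff, Set.mem_singleton_iff, @eq_comm _ x]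
  rfl

theorem span_pair_sq (a c : Poly K) :
    Submodule.span K {a, c} ^ 2 = Submodule.span K {a ^ 2, a * c, c ^ 2} := by
  rw [sq, Submodule.span_mul_span]
  congr 1
  ext x
  simp only [Set.mem_mul, Set.mem_insert_iff, Set.mem_singleton_iff]
  constructor
  · rintro ⟨y, rfl | rfl, z, rfl | rfl, rfl⟩
    · exact Or.inl (sq _).symm
    · exact Or.inr (Or.inl rfl)
    · exact Or.inr (Or.inl (mul_comm _ _))
    · exact Or.inr (Or.inr (sq _).symm)
  · rintro (rfl | rfl | rfl)
    · exact ⟨a, Or.inl rfl, a, Or.inl rfl, (sq _).symm⟩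
    · exact ⟨a, Or.inl rfl, c, Or.inr rfl, rfl⟩
    · exact ⟨c, Or.inr rfl, c, Or.inr rfl, (sq _).symm⟩

/-- Total degrees add in a domain, so `a` has degree at most one; its constant term squares to zero.
-/
theorem mem_forms_one_of_sq {a : Poly K} (h : a ^ 2 ∈ Forms K 2) : a ∈ Forms K 1 := by
  by_cases ha : a = 0
  · rw [ha]; exact zero_mem _
  have ht : a.totalDegree = 1 := by
    have h1 := IsHomogeneous.totalDegree h (pow_ne_zero 2 ha)
    rw [sq, totalDegree_mul_of_isDomain ha ha] at h1
    omega
  have h0 : coeff 0 a = 0 := by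
    have h1 : constantCoeff (a ^ 2) = 0 := IsHomogeneous.coeff_eq_zero h (by simp)
    rw [map_pow] at h1
    exact pow_eq_zero_iff (two_ne_zero) |>.1 h1
  intro m hm
  have h1 : m.degree ≤ 1 := ht ▸ le_totalDegree (mem_support_iff.2 hm)
  have h2 : m.degree ≠ 0 := by
    intro h
    rw [Finsupp.degree_eq_zero_iff] at h
    exact hm (h ▸ h0)
  have h3 : m.degree = 1 := by omega
  rwa [Finsupp.degree_eq_weight_one] at h3

/-- After removing the gcd, the cofactors of `A` and `C'` are coprime with square product, so each
is a unit times a square. The degrees leave room either for the gcd or for the squares, and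
independence excludes the first case. -/
theorem exists_square_net [IsAlgClosed K] {A B C' : Poly K} (hA : A ∈ Forms K 2)
    (hC : C' ∈ Forms K 2) (hli : LinearIndependent K ![A, B, C']) (h : A * C' = B ^ 2) :
    ∃ Λ : Submodule K (Poly K), IsLine Λ ∧ Submodule.span K {A, B, C'} = Λ ^ 2 := by
  classical
  have : GCDMonoid (Poly K) := UniqueFactorizationMonoid.toGCDMonoid _
  have hAC : LinearIndependent K ![A, C'] := by
    have := hli.comp ![0, 2] (by decide)
    convert this using 1
    ext i
    fin_cases i <;> rfl
  rw [LinearIndependent.pair_iff] at hAC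
  have hA0 : A ≠ 0 := hli.ne_zero 0
  have hC0 : C' ≠ 0 := hli.ne_zero 2
  obtain ⟨a', c', ha', hc', hu⟩ := extract_gcd A C'
  set g := gcd A C' with hg
  have hg0 : g ≠ 0 := by
    rintro h0
    rw [h0, zero_mul] at ha'
    exact hA0 ha'
  obtain ⟨b', hb'⟩ : g ∣ B := by
    rw [← IsIntegrallyClosed.pow_dvd_pow_iff (two_ne_zero), ← h]
    exact ⟨a' * c', by rw [ha', hc']; ring⟩
  have hab : a' * c' = b' ^ 2 := by
    refine mul_left_cancel₀ (pow_ne_zero 2 hg0) ?_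
    rw [← mul_pow, ← hb', ← h]
    linear_combination (-C') * ha' - g * a' * hc'
  obtain ⟨d, u, hd⟩ := exists_associated_pow_of_mul_eq_pow hu hab
  have hu' : IsUnit (gcd c' a') := (gcd_comm' a' c').isUnit hu
  obtain ⟨e, w, he⟩ := exists_associated_pow_of_mul_eq_pow hu' ((mul_comm _ _).trans hab)
  obtain ⟨γ, hγ, hγ'⟩ := isUnit_iff_eq_C_of_isReduced.1 u.isUnit
  obtain ⟨δ, hδ, hδ'⟩ := isUnit_iff_eq_C_of_isReduced.1 w.isUnit
  rw [hγ'] at hd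
  rw [hδ'] at he
  rw [← hd] at ha'
  rw [← he] at hc'
  have hγ0 := hγ.ne_zero
  have hδ0 := hδ.ne_zero
  have hd0 : d ≠ 0 := by rintro rfl; apply hA0; rw [ha']; ring
  have he0 : e ≠ 0 := by rintro rfl; apply hC0; rw [hc']; ring
  have hCγ : (C γ : Poly K) ≠ 0 := by simpa using hγ0
  have hCδ : (C δ : Poly K) ≠ 0 := by simpa using hδ0
  have tA : g.totalDegree + 2 * d.totalDegree = 2 := by
    have := IsHomogeneous.totalDegree hA hA0
    rw [ha', totalDegree_mul_of_isDomain hg0 (mul_ne_zero (pow_ne_zero 2 hd0) hCγ),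
      totalDegree_mul_of_isDomain (pow_ne_zero 2 hd0) hCγ, sq,
      totalDegree_mul_of_isDomain hd0 hd0, totalDegree_C] at this
    omega
  have tC : g.totalDegree + 2 * e.totalDegree = 2 := by
    have := IsHomogeneous.totalDegree hC hC0
    rw [hc', totalDegree_mul_of_isDomain hg0 (mul_ne_zero (pow_ne_zero 2 he0) hCδ),
      totalDegree_mul_of_isDomain (pow_ne_zero 2 he0) hCδ, sq,
      totalDegree_mul_of_isDomain he0 he0, totalDegree_C] at this
    omega
  -- If `d` were constant, so would be `e`, and `A`, `C'` would both be scalar multiples of the gcd.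
  have hdd : d.totalDegree ≠ 0 := by
    intro hd1
    have he1 : e.totalDegree = 0 := by omega
    rw [totalDegree_eq_zero_iff_eq_C] at hd1 he1
    rw [hd1] at ha'
    rw [he1] at hc'
    generalize coeff 0 d = d1 at *
    generalize coeff 0 e = e1 at *
    have h3 : (e1 ^ 2 * δ) • A + (-(d1 ^ 2 * γ)) • C' = 0 := by
      rw [ha', hc', smul_eq_C_mul, smul_eq_C_mul]
      simp only [map_mul, map_pow, map_neg]
      ring
    have h4 := (hAC _ _ h3).1
    apply he0
    rw [he1]
    have : e1 = 0 := by
      rcases mul_eq_zero.1 h4 with h5 | h5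
      · exact pow_eq_zero_iff two_ne_zero |>.1 h5
      · exact absurd h5 hδ0
    rw [this, map_zero]
  have hg1 : g.totalDegree = 0 := by omega
  rw [totalDegree_eq_zero_iff_eq_C] at hg1
  -- The constant gcd and the units are absorbed into the squares by extracting square roots in `K`.
  obtain ⟨μ, hμ⟩ := IsAlgClosed.exists_eq_mul_self (coeff 0 g * γ)
  obtain ⟨ν, hν⟩ := IsAlgClosed.exists_eq_mul_self (coeff 0 g * δ)
  obtain ⟨a, ha⟩ : ∃ a, A = a ^ 2 := ⟨C μ * d, by
    rw [ha', hg1, mul_pow, sq (C μ), ← map_mul, ← hμ, map_mul]; ring⟩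
  obtain ⟨c, hc, hB⟩ : ∃ c, C' = c ^ 2 ∧ B = a * c := by
    have hc1 : C' = (C ν * e) ^ 2 := by
      rw [hc', hg1, mul_pow, sq (C ν), ← map_mul, ← hν, map_mul]; ring
    have h5 : B ^ 2 = (a * (C ν * e)) ^ 2 := by rw [← h, ha, hc1]; ring
    rcases sq_eq_sq_iff_eq_or_eq_neg.1 h5 with h6 | h6
    · exact ⟨_, hc1, h6⟩
    · exact ⟨-(C ν * e), by rw [hc1]; ring, by rw [h6]; ring⟩
  subst ha hc hB
  refine ⟨Submodule.span K {a, c}, ⟨?_, ?_⟩, (span_pair_sq a c).symm⟩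
  · rw [Submodule.span_le]
    rintro _ (rfl | rfl)
    · exact mem_forms_one_of_sq hA
    · exact mem_forms_one_of_sq hC
  · have hl : LinearIndependent K ![a, c] := by
      rw [LinearIndependent.pair_iff]
      intro s t hst
      have h6 : s • a = -(t • c) := eq_neg_of_add_eq_zero_left hst
      have h7 : (s ^ 2) • a ^ 2 + (-t ^ 2) • c ^ 2 = 0 := by
        rw [← smul_pow, h6, neg_smul, ← smul_pow]; ring
      obtain ⟨h8, h9⟩ := hAC _ _ h7
      simpa using And.intro h8 h9
    have := finrank_span_eq_card hl
    rwa [range_vec_two] at this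

theorem mul_eq_zero_of_linearIndependent {ι : Type*} [Fintype ι]
    {q : ι → Poly K} (hq : LinearIndependent K q)
    {a b : ι → K} (h : (∑ i, a i • q i) * (∑ i, b i • q i) = 0) : a = 0 ∨ b = 0 := by
  rw [Fintype.linearIndependent_iff] at hq
  rcases mul_eq_zero.1 h with h | h
  · exact Or.inl (funext (hq _ h))
  · exact Or.inr (funext (hq _ h))

/-- With all three coefficients nonzero, scaling gives `x² + y² + z² = 0`, that is `(x + I y) (x - I
y) = (I z)²`, and the three forms in this equation span the same net. -/
theorem exists_square_net_of_diagonal [IsAlgClosed K] [CharZero K]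
    {q : Fin 3 → Poly K} (hq : LinearIndependent K q)
    (h2 : ∀ i, q i ∈ Forms K 2) {D : Fin 3 → K} (hD : D ≠ 0) (h : ∑ i, D i • q i ^ 2 = 0) :
    ∃ Λ : Submodule K (Poly K), IsLine Λ ∧ Submodule.span K (Set.range q) = Λ ^ 2 := by
  obtain ⟨I, hI⟩ := IsAlgClosed.exists_eq_mul_self (-1 : K)
  have hI0 : I ≠ 0 := by rintro rfl; simp at hI
  have hCI : (C I : Poly K) * C I = -1 := by rw [← map_mul, ← hI]; simp
  choose r hr using fun i => IsAlgClosed.exists_eq_mul_self (D i)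
  have hrel : (C (r 0) * q 0) ^ 2 + (C (r 1) * q 1) ^ 2 + (C (r 2) * q 2) ^ 2 = 0 := by
    rw [← h, Fin.sum_univ_three]
    simp only [smul_eq_C_mul, hr, map_mul]
    ring
  have hne : ∀ i, r i ≠ 0 := by
    -- A relation with a vanishing coefficient is a sum of two squares and splits into two linear
    -- factors in the net; one of them must be zero, which kills all coefficients.
    have key : ∀ σ : Equiv.Perm (Fin 3), r (σ 2) = 0 → False := by
      intro σ h0
      have hs : ∑ i, (C (r (σ i)) * q (σ i)) ^ 2 = 0 := by
        rw [Equiv.sum_comp σ (fun i => (C (r i) * q i) ^ 2), Fin.sum_univ_three, hrel]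
      rw [Fin.sum_univ_three, h0, C_0] at hs
      have hq' : LinearIndependent K (q ∘ σ) := hq.comp _ σ.injective
      have h1 := mul_eq_zero_of_linearIndependent hq' (a := ![r (σ 0), I * r (σ 1), 0])
        (b := ![r (σ 0), -I * r (σ 1), 0]) (by
          simp only [Fin.sum_univ_three, smul_eq_C_mul, Function.comp_apply, Matrix.cons_val,
            map_mul, map_neg, map_zero]
          linear_combination hs - (C (r (σ 1)) * q (σ 1)) ^ 2 * hCI)
      have h01 : r (σ 0) = 0 ∧ r (σ 1) = 0 := by
        rcases h1 with h1 | h1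
        · have e0 := congrFun h1 0
          have e1 := congrFun h1 1
          simp [hI0] at e0 e1
          exact ⟨e0, e1⟩
        · have e0 := congrFun h1 0
          have e1 := congrFun h1 1
          simp [hI0] at e0 e1
          exact ⟨e0, e1⟩
      apply hD
      ext i
      obtain ⟨j, rfl⟩ := σ.surjective i
      rw [hr]
      fin_cases j <;> simp [h01.1, h01.2, h0]
    intro i hi
    exact key (Equiv.swap 2 i) (by simpa using hi)
  set q0 := C (r 0) * q 0
  set q1 := C (r 1) * q 1
  set q2 := C (r 2) * q 2
  have hm : ∀ i, C (r i) * q i ∈ Forms K 2 := fun i => by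
    rw [← smul_eq_C_mul]; exact Submodule.smul_mem _ _ (h2 i)
  have hspan : Submodule.span K {q0 + C I * q1, C I * q2, q0 - C I * q1} =
      Submodule.span K (Set.range q) := by
    apply le_antisymm
    · rw [Submodule.span_le]
      have hmem : ∀ i (x : K), C x * q i ∈ Submodule.span K (Set.range q) := fun i x => by
        rw [← smul_eq_C_mul]
        exact Submodule.smul_mem _ _ (Submodule.subset_span ⟨i, rfl⟩)
      have e1 : C I * q1 = C (I * r 1) * q 1 := by rw [map_mul, mul_assoc]
      have e2 : C I * q2 = C (I * r 2) * q 2 := by rw [map_mul, mul_assoc]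
      rintro _ (rfl | rfl | rfl)
      · rw [e1]; exact add_mem (hmem _ _) (hmem _ _)
      · rw [e2]; exact hmem _ _
      · rw [e1]; exact sub_mem (hmem _ _) (hmem _ _)
    · rw [Submodule.span_le]
      rintro _ ⟨i, rfl⟩
      have m0 : q0 + C I * q1 ∈ Submodule.span K {q0 + C I * q1, C I * q2, q0 - C I * q1} :=
        Submodule.subset_span (by simp)
      have m1 : C I * q2 ∈ Submodule.span K {q0 + C I * q1, C I * q2, q0 - C I * q1} :=
        Submodule.subset_span (by simp)
      have m2 : q0 - C I * q1 ∈ Submodule.span K {q0 + C I * q1, C I * q2, q0 - C I * q1} :=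
        Submodule.subset_span (by simp)
      have hri : ∀ i, (C ((r i)⁻¹) : Poly K) * C (r i) = 1 := fun i => by
        rw [← map_mul, inv_mul_cancel₀ (hne i), map_one]
      have hII : (C I⁻¹ : Poly K) * C I = 1 := by rw [← map_mul, inv_mul_cancel₀ hI0, map_one]
      have h2' : (C (2⁻¹ : K) : Poly K) * 2 = 1 := by
        have : (2 : Poly K) = C 2 := (map_ofNat C 2).symm
        rw [this, ← map_mul, inv_mul_cancel₀ two_ne_zero, map_one]
      fin_cases i
      · have : q 0 = (2⁻¹ * (r 0)⁻¹) • ((q0 + C I * q1) + (q0 - C I * q1)) := by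
          rw [smul_eq_C_mul, map_mul]
          simp only [q0]
          linear_combination -q 0 * (C (2⁻¹ : K) * 2) * hri 0 - q 0 * h2'
        change q 0 ∈ _
        rw [this]
        exact Submodule.smul_mem _ _ (add_mem m0 m2)
      · have : q 1 = (2⁻¹ * I⁻¹ * (r 1)⁻¹) • ((q0 + C I * q1) - (q0 - C I * q1)) := by
          rw [smul_eq_C_mul, map_mul, map_mul]
          simp only [q1]
          linear_combination -q 1 * (C (2⁻¹ : K) * 2) * (C I⁻¹ * C I) * hri 1 -
            q 1 * (C (2⁻¹ : K) * 2) * hII - q 1 * h2'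
        change q 1 ∈ _
        rw [this]
        exact Submodule.smul_mem _ _ (sub_mem m0 m2)
      · have : q 2 = (I⁻¹ * (r 2)⁻¹) • (C I * q2) := by
          rw [smul_eq_C_mul, map_mul]
          simp only [q2]
          linear_combination -q 2 * (C I⁻¹ * C I) * hri 2 - q 2 * hII
        change q 2 ∈ _
        rw [this]
        exact Submodule.smul_mem _ _ m1
  have hli : LinearIndependent K ![q0 + C I * q1, C I * q2, q0 - C I * q1] := by
    rw [linearIndependent_iff_card_eq_finrank_span, Set.finrank, range_vec_three, hspan,
      finrank_span_eq_card hq]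
  have hCm : ∀ {x}, x ∈ Forms K 2 → C I * x ∈ Forms K 2 := fun hx => by
    rw [← smul_eq_C_mul]; exact Submodule.smul_mem _ _ hx
  obtain ⟨Λ, hΛ, hΛ'⟩ := exists_square_net (A := q0 + C I * q1) (B := C I * q2)
    (C' := q0 - C I * q1) (add_mem (hm 0) (hCm (hm 1))) (sub_mem (hm 0) (hCm (hm 1))) hli
    (by linear_combination hrel - (q1 ^ 2 + q2 ^ 2) * hCI)
  exact ⟨Λ, hΛ, hspan ▸ hΛ'⟩

/-- An orthogonal basis for the symmetric bilinear form of the relation reduces it to the diagonal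
case. -/
theorem exists_square_net_of_relation [IsAlgClosed K] [CharZero K]
    {q : Fin 3 → Poly K} (hq : LinearIndependent K q)
    (h2 : ∀ i, q i ∈ Forms K 2) {M : Matrix (Fin 3) (Fin 3) K} (hM : M.IsSymm) (hM0 : M ≠ 0)
    (h : ∑ i, ∑ j, M i j • (q i * q j) = 0) :
    ∃ Λ : Submodule K (Poly K), IsLine Λ ∧ Submodule.span K (Set.range q) = Λ ^ 2 := by
  have : Invertible (2 : K) := invertibleOfNonzero two_ne_zero
  obtain ⟨v, hv⟩ := LinearMap.BilinForm.exists_orthogonal_basis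
    (B := Matrix.toBilin' M) ⟨(Matrix.isSymm_toBilin'_iff_isSymm.2 hM).eq⟩
  let b : Basis (Fin 3) K (Fin 3 → K) := v.reindex (finCongr (by simp))
  have hb : ∀ i j, i ≠ j → Matrix.toBilin' M (b i) (b j) = 0 := by
    intro i j hij
    simp only [b, Basis.reindex_apply]
    exact hv (by simpa using hij)
  let P : Matrix (Fin 3) (Fin 3) K := fun k i => b.repr (Pi.single i 1) k
  let D : Fin 3 → K := fun k => Matrix.toBilin' M (b k) (b k)
  have hMP : ∀ i j, M i j = ∑ k, D k * (P k i * P k j) := by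
    intro i j
    have e1 : M i j = Matrix.toBilin' M (Pi.single i 1) (Pi.single j 1) := by simp
    rw [e1]
    conv_lhs => rw [← b.sum_repr (Pi.single i 1), ← b.sum_repr (Pi.single j 1)]
    simp only [map_sum, LinearMap.sum_apply, map_smul, LinearMap.smul_apply, smul_eq_mul]
    rw [Finset.sum_congr rfl fun k _ => ?_]
    rw [Finset.sum_eq_single k]
    · simp only [P, D]; ring
    · intro l _ hl
      rw [hb l k hl]
      ring
    · simp
  let q' : Fin 3 → Poly K := fun k => ∑ i, P k i • q i
  have hqq' : ∀ i, q i = ∑ k, b k i • q' k := by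
    intro i
    have e1 : ∀ j, ∑ k, P k j * b k i = (Pi.single j 1 : Fin 3 → K) i := fun j => by
      have := congrFun (b.sum_repr (Pi.single j 1)) i
      simpa [Finset.sum_apply] using this
    simp only [q', Finset.smul_sum, smul_smul]
    rw [Finset.sum_comm]
    simp only [← Finset.sum_smul, mul_comm (b _ i), e1]
    simp [Pi.single_apply]
  have hD : D ≠ 0 := by
    intro h0
    apply hM0
    ext i j
    rw [hMP]
    simp [h0]
  have hrel : ∑ k, D k • q' k ^ 2 = 0 := by
    rw [← h]
    simp only [hMP, q', Fin.sum_univ_three, smul_eq_C_mul, map_add, map_mul]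
    ring
  have hspan : Submodule.span K (Set.range q') = Submodule.span K (Set.range q) := by
    apply le_antisymm <;> rw [Submodule.span_le] <;> rintro _ ⟨i, rfl⟩
    · exact sum_mem fun j _ => Submodule.smul_mem _ _ (Submodule.subset_span ⟨j, rfl⟩)
    · rw [hqq']
      exact sum_mem fun j _ => Submodule.smul_mem _ _ (Submodule.subset_span ⟨j, rfl⟩)
  have hli : LinearIndependent K q' := by
    rw [linearIndependent_iff_card_eq_finrank_span, Set.finrank, hspan, finrank_span_eq_card hq]
  rw [← hspan]
  exact exists_square_net_of_diagonal hli
    (fun k => sum_mem fun i _ => Submodule.smul_mem _ _ (h2 i)) hD hrel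

theorem detNets_le_forms {π : Submodule K (Poly K)} (hπ : π ∈ detNets K) : π ≤ Forms K 2 := by
  obtain ⟨-, A, hA, rfl⟩ := hπ
  rw [Submodule.span_le]
  rintro _ ⟨i, rfl⟩
  simp only [minors, Matrix.det_fin_two]
  exact sub_mem (IsHomogeneous.mul (hA _ _) (hA _ _)) (IsHomogeneous.mul (hA _ _) (hA _ _))

theorem exists_basis_of_detNets {π : Submodule K (Poly K)} (hπ : π ∈ detNets K) :
    ∃ q : Fin 3 → Poly K, LinearIndependent K q ∧ Submodule.span K (Set.range q) = π := by
  obtain ⟨h3, A, hA, rfl⟩ := hπ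
  refine ⟨minors A, ?_, rfl⟩
  rw [linearIndependent_iff_card_eq_finrank_span, Set.finrank, h3]
  rfl

theorem sq_eq_span {π : Submodule K (Poly K)} {q : Fin 3 → Poly K}
    (hq : Submodule.span K (Set.range q) = π) : π ^ 2 = Submodule.span K
      (Set.range ![q 0 * q 0, q 0 * q 1, q 0 * q 2, q 1 * q 1, q 1 * q 2, q 2 * q 2]) := by
  rw [← hq, sq, Submodule.span_mul_span]
  congr 1
  ext x
  constructor
  · rintro ⟨_, ⟨i, rfl⟩, _, ⟨j, rfl⟩, rfl⟩
    fin_cases i <;> fin_cases j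
    · exact ⟨0, rfl⟩
    · exact ⟨1, rfl⟩
    · exact ⟨2, rfl⟩
    · exact ⟨1, mul_comm _ _⟩
    · exact ⟨3, rfl⟩
    · exact ⟨4, rfl⟩
    · exact ⟨2, mul_comm _ _⟩
    · exact ⟨4, mul_comm _ _⟩
    · exact ⟨5, rfl⟩
  · rintro ⟨i, rfl⟩
    fin_cases i
    exacts [⟨_, ⟨0, rfl⟩, _, ⟨0, rfl⟩, rfl⟩, ⟨_, ⟨0, rfl⟩, _, ⟨1, rfl⟩, rfl⟩,
      ⟨_, ⟨0, rfl⟩, _, ⟨2, rfl⟩, rfl⟩, ⟨_, ⟨1, rfl⟩, _, ⟨1, rfl⟩, rfl⟩,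
      ⟨_, ⟨1, rfl⟩, _, ⟨2, rfl⟩, rfl⟩, ⟨_, ⟨2, rfl⟩, _, ⟨2, rfl⟩, rfl⟩]

theorem finrank_sq_le {π : Submodule K (Poly K)} (hπ : π ∈ detNets K) :
    finrank K ↥(π ^ 2) ≤ 6 := by
  obtain ⟨q, -, hq⟩ := exists_basis_of_detNets hπ
  rw [sq_eq_span hq]
  exact finrank_range_le_card _

theorem finrank_sq_eq [IsAlgClosed K] [CharZero K] {π : Submodule K (Poly K)}
    (hπ : π ∈ detNets K) (hπ' : π ∉ squareNets K) :
    finrank K ↥(π ^ 2) = 6 := by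
  obtain ⟨q, hli, hq⟩ := exists_basis_of_detNets hπ
  rw [sq_eq_span hq]
  by_contra hne
  have hdep : ¬ LinearIndependent K
      ![q 0 * q 0, q 0 * q 1, q 0 * q 2, q 1 * q 1, q 1 * q 2, q 2 * q 2] :=
    fun h => hne (finrank_span_eq_card h)
  obtain ⟨g, hg, i, hi⟩ := Fintype.not_linearIndependent_iff.1 hdep
  -- The Gram matrix of twice the relation, which avoids halving the mixed coefficients.
  let M : Matrix (Fin 3) (Fin 3) K := !![2 * g 0, g 1, g 2; g 1, 2 * g 3, g 4; g 2, g 4, 2 * g 5]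
  apply hπ'
  rw [← hq]
  refine exists_square_net_of_relation hli
    (fun i => detNets_le_forms hπ (hq ▸ Submodule.subset_span ⟨i, rfl⟩)) (M := M) ?_ ?_ ?_
  · ext i j
    fin_cases i <;> fin_cases j <;> rfl
  · intro h0
    apply hi
    have e := fun i j => congrFun (congrFun h0 i) j
    have e0 := e 0 0
    have e1 := e 0 1
    have e2 := e 0 2
    have e3 := e 1 1
    have e4 := e 1 2
    have e5 := e 2 2
    simp [M] at e0 e1 e2 e3 e4 e5
    fin_cases i <;> assumption
  · have h2 : (2 : Poly K) = C 2 := (map_ofNat C 2).symm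
    simp only [Fin.sum_univ_six, smul_eq_C_mul] at hg
    simp only [Fin.sum_univ_three, smul_eq_C_mul, M]
    simp at hg ⊢
    linear_combination 2 * hg - (C (g 0) * q 0 ^ 2 + C (g 3) * q 1 ^ 2 + C (g 5) * q 2 ^ 2) * h2

end Conic

/-! ### Plücker coordinates and Cramer's rule -/

section Plucker

variable {K : Type*} [Field K]

noncomputable instance : Fintype QuadMon := Fintype.ofFinite _

theorem eq_sum_of_mem_forms_two {q : Poly K} (hq : q ∈ Forms K 2) :
    q = ∑ n : QuadMon, monomial n.1 (coeff n.1 q) := by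
  ext m
  rw [coeff_sum]
  by_cases hm : m.degree = 2
  · rw [Finset.sum_eq_single (⟨m, hm⟩ : QuadMon)]
    · simp
    · intro n _ hn
      rw [coeff_monomial, if_neg]
      exact fun h => hn (Subtype.ext h)
    · simp
  · rw [IsHomogeneous.coeff_eq_zero hq hm, Finset.sum_eq_zero]
    intro n _
    rw [coeff_monomial, if_neg]
    exact fun h => hm (h ▸ n.2)

/-- The scalar is the determinant of the change of basis. -/
theorem IsPlucker.exists_smul {π : Submodule K (Poly K)} {p p' : PIdx → K}
    (hp : IsPlucker π p) (hp' : IsPlucker π p') : ∃ t : K, t ≠ 0 ∧ p' = t • p := by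
  obtain ⟨q, hq, rfl, rfl⟩ := hp
  obtain ⟨q', hq', hs, rfl⟩ := hp'
  have hT : ∀ i, ∃ T : Fin 3 → K, ∑ j, T j • q j = q' i := fun i =>
    (Submodule.mem_span_range_iff_exists_fun K).1 (hs ▸ Submodule.subset_span ⟨i, rfl⟩)
  choose T hT using hT
  refine ⟨(Matrix.of T).det, ?_, ?_⟩
  · intro h0
    obtain ⟨x, hx, hx0⟩ := Matrix.exists_vecMul_eq_zero_iff.2 h0
    apply hx
    refine funext (Fintype.linearIndependent_iff.1 hq' x ?_)
    simp only [← hT, Finset.smul_sum, smul_smul]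
    rw [Finset.sum_comm]
    refine Finset.sum_eq_zero fun j _ => ?_
    rw [← Finset.sum_smul]
    have := congrFun hx0 j
    simp only [Matrix.vecMul, dotProduct, Matrix.of_apply, Pi.zero_apply] at this
    rw [this, zero_smul]
  · funext s
    simp only [plucker, Pi.smul_apply, smul_eq_mul]
    rw [← Matrix.det_mul]
    congr 1
    ext i j
    simp [← hT, Matrix.mul_apply, coeff_sum]

/-- The coefficient columns span `K³`, since a functional killing them all would be a linear
relation among the basis forms; three independent columns give a nonzero minor. -/
theorem IsPlucker.exists_ne_zero {π : Submodule K (Poly K)} {p : PIdx → K}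
    (hp : IsPlucker π p) (hπ : π ≤ Forms K 2) : ∃ s, p s ≠ 0 := by
  obtain ⟨q, hq, rfl, rfl⟩ := hp
  let col : QuadMon → Fin 3 → K := fun n i => coeff n.1 (q i)
  have htop : Submodule.span K (Set.range col) = ⊤ := by
    by_contra hne
    obtain ⟨φ, hφ, hφ'⟩ := Submodule.exists_le_ker_of_lt_top _ (lt_top_iff_ne_top.2 hne)
    apply hφ
    have h0 : ∀ i, φ (Pi.single i 1) = 0 := by
      refine Fintype.linearIndependent_iff.1 hq _ ?_
      rw [eq_sum_of_mem_forms_two (sum_mem fun i _ => Submodule.smul_mem (Forms K 2) _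
        (hπ (Submodule.subset_span ⟨i, rfl⟩)))]
      refine Finset.sum_eq_zero fun n _ => ?_
      have h1 : φ (col n) = 0 := hφ' (Submodule.subset_span ⟨n, rfl⟩)
      rw [monomial_eq_zero, ← h1]
      conv_rhs => rw [← Finset.univ_sum_single (col n), map_sum]
      rw [coeff_sum]
      refine Finset.sum_congr rfl fun i _ => ?_
      rw [coeff_smul, smul_eq_mul, mul_comm, ← smul_eq_mul, ← map_smul, ← Pi.single_smul]
      simp [col]
    refine LinearMap.pi_ext' fun i => LinearMap.ext_ring ?_
    simpa using h0 i
  obtain ⟨g, hg, -, hli⟩ := Submodule.exists_fun_fin_finrank_span_eq K (Set.range col)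
  have h3 : finrank K (Submodule.span K (Set.range col)) = 3 := by
    rw [htop, finrank_top, finrank_fin_fun]
  choose s hs using hg
  refine ⟨fun j => s (Fin.cast h3.symm j), ?_⟩
  have hli' : LinearIndependent K (fun j => g (Fin.cast h3.symm j)) :=
    hli.comp _ (Fin.cast_injective _)
  have h4 := Matrix.linearIndependent_rows_iff_isUnit
    (A := (Matrix.of fun j => g (Fin.cast h3.symm j))).1 hli'
  rw [Matrix.isUnit_iff_isUnit_det] at h4
  have h5 := h4.ne_zero
  rw [← Matrix.det_transpose] at h5
  have h6 : (Matrix.of fun j => g (Fin.cast h3.symm j)).transpose =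
      Matrix.of fun i j => coeff (s (Fin.cast h3.symm j)).1 (q i) := by
    ext i j
    simp [← hs, col]
  rw [h6] at h5
  exact h5

/-- The quadratic forms obtained from Plücker coordinates by Cramer's rule: the `k`-th member of
the basis of the net that is dual to the three coefficients `s`. -/
noncomputable def cramerForm {R : Type*} [CommRing R] (p : PIdx → R) (s : PIdx) (k : Fin 3) :
    MvPolynomial (Fin 4) R :=
  ∑ n : QuadMon, monomial n.1 (p (Function.update s k n))

theorem map_cramerForm {R S : Type*} [CommRing R] [CommRing S] (φ : R →+* S) (p : PIdx → R)
    (s : PIdx) (k : Fin 3) :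
    MvPolynomial.map φ (cramerForm p s k) = cramerForm (fun i => φ (p i)) s k := by
  simp [cramerForm, map_monomial]

/-- Replacing one column of the minor by the column of `n` is Cramer's rule, hence the adjugate.
This produces elements of the net that are linear in its Plücker coordinates. -/
theorem cramerForm_plucker {q : Fin 3 → Poly K} (hq : ∀ i, q i ∈ Forms K 2) (s : PIdx)
    (k : Fin 3) : cramerForm (plucker q) s k =
      ∑ i, (Matrix.of fun i j : Fin 3 => coeff (s j).1 (q i)).adjugate k i • q i := by
  have h1 : ∀ n : QuadMon, plucker q (Function.update s k n) =
      ∑ i, (Matrix.of fun i j : Fin 3 => coeff (s j).1 (q i)).adjugate k i * coeff n.1 (q i) := by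
    intro n
    have h2 : (Matrix.of fun i j : Fin 3 => coeff (Function.update s k n j).1 (q i)) =
        (Matrix.of fun i j : Fin 3 => coeff (s j).1 (q i)).updateCol k
          (fun i => coeff n.1 (q i)) := by
      ext i j
      by_cases hj : j = k
      · subst hj; simp
      · simp [hj]
    rw [plucker, h2, ← Matrix.cramer_apply, Matrix.cramer_eq_adjugate_mulVec]
    rfl
  simp only [cramerForm, h1, map_sum]
  rw [Finset.sum_comm]
  refine Finset.sum_congr rfl fun i _ => ?_
  conv_rhs => rw [eq_sum_of_mem_forms_two (hq i), Finset.smul_sum]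
  simp [smul_monomial]

theorem cramerForm_mem {π : Submodule K (Poly K)} (hπ : π ≤ Forms K 2) {p : PIdx → K}
    (hp : IsPlucker π p) (s : PIdx) (k : Fin 3) : cramerForm p s k ∈ π := by
  obtain ⟨q, hq, rfl, rfl⟩ := hp
  rw [cramerForm_plucker fun i => hπ (Submodule.subset_span ⟨i, rfl⟩)]
  exact sum_mem fun i _ => Submodule.smul_mem _ _ (Submodule.subset_span ⟨i, rfl⟩)

theorem span_cramerForm {π : Submodule K (Poly K)} (hπ : π ≤ Forms K 2) {p : PIdx → K}
    (hp : IsPlucker π p) {s : PIdx} (hs : p s ≠ 0) :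
    Submodule.span K (Set.range (cramerForm p s)) = π := by
  apply le_antisymm
  · rw [Submodule.span_le]
    rintro _ ⟨k, rfl⟩
    exact cramerForm_mem hπ hp s k
  · obtain ⟨q, hq, rfl, rfl⟩ := hp
    rw [Submodule.span_le]
    rintro _ ⟨i, rfl⟩
    set M := Matrix.of fun i j : Fin 3 => coeff (s j).1 (q i) with hM
    have hs : M.det ≠ 0 := hs
    have h1 : q i = M.det⁻¹ • ∑ k, M i k • cramerForm (plucker q) s k := by
      simp only [cramerForm_plucker fun i => hπ (Submodule.subset_span ⟨i, rfl⟩), ← hM,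
        Finset.smul_sum, smul_smul]
      rw [Finset.sum_comm]
      have h2 : ∀ j, ∑ k, M i k * M.adjugate k j = if i = j then M.det else 0 := fun j => by
        have := congrFun (congrFun M.mul_adjugate i) j
        simpa [Matrix.mul_apply, Matrix.one_apply] using this
      simp only [← Finset.sum_smul, ← Finset.mul_sum, h2]
      simp [hs]
    rw [h1]
    exact Submodule.smul_mem _ _ (sum_mem fun k _ => Submodule.smul_mem _ _
      (Submodule.subset_span ⟨k, rfl⟩))

theorem exists_isPlucker {π : Submodule K (Poly K)} (hπ : π ∈ detNets K) :
    ∃ p, IsPlucker π p := by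
  obtain ⟨q, hq, h⟩ := exists_basis_of_detNets hπ
  exact ⟨_, q, hq, h, rfl⟩

end Plucker

/-! ### Closed conditions on the blow-up and uniqueness of the bundle -/

section Coordinates

variable {K : Type*} [Field K] {m : ℕ}

theorem exists_isCoord {z : Pt K m} (hz : z.1 ∈ detNets K) : ∃ c, IsCoord z c := by
  obtain ⟨p, hp⟩ := exists_isPlucker hz
  exact ⟨Sum.elim p z.2.rep, hp, z.2.rep_nonzero, z.2.mk_rep.symm⟩

theorem IsCoord.exists_scale {z : Pt K m} {c c' : PIdx ⊕ Fin m → K} (hc : IsCoord z c)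
    (hc' : IsCoord z c') : ∃ a b : K, a ≠ 0 ∧ b ≠ 0 ∧
      (∀ s, c' (Sum.inl s) = a * c (Sum.inl s)) ∧ ∀ i, c' (Sum.inr i) = b * c (Sum.inr i) := by
  obtain ⟨a, ha, h1⟩ := hc.1.exists_smul hc'.1
  obtain ⟨h2, h3⟩ := hc.2
  obtain ⟨h4, h5⟩ := hc'.2
  obtain ⟨b, hb⟩ := (Projectivization.mk_eq_mk_iff K _ _ h4 h2).1 (h5 ▸ h3)
  exact ⟨a, b, ha, b.ne_zero, fun s => congrFun h1 s, fun i => (congrFun hb i).symm⟩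

theorem graph_subset_blowup (f : Fin m → MvPolynomial PIdx K) : graph f ⊆ blowup f :=
  fun _ hz => ⟨hz.1, fun _ hG c hc => hG _ hz c hc⟩

/-- Dependence passes from the graph to its closure: the polynomial `h` times a determinant vanishes
on the graph, the factor `h` covering the points where the hypothesis says nothing. -/
theorem not_linearIndependent_of_graph {f : Fin m → MvPolynomial PIdx K} {n : ℕ}
    (s : Fin n → MvPolynomial (Fin 4) (MvPolynomial (PIdx ⊕ Fin m) K))
    (h : MvPolynomial (PIdx ⊕ Fin m) K)
    (H : ∀ w ∈ graph f, ∀ c, IsCoord w c → eval c h ≠ 0 →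
      ¬ LinearIndependent K fun j => MvPolynomial.map (eval c) (s j))
    {z : Pt K m} (hz : z ∈ blowup f) {c : PIdx ⊕ Fin m → K} (hc : IsCoord z c)
    (hh : eval c h ≠ 0) : ¬ LinearIndependent K fun j => MvPolynomial.map (eval c) (s j) := by
  intro hli
  obtain ⟨φ, hφ⟩ := exists_functionals_det_ne_zero hli
  obtain ⟨G, hG⟩ := exists_eval_eq_det φ s
  have h0 : eval c (h * G) = 0 := by
    refine hz.2 _ (fun w hw c' hc' => ?_) c hc
    rw [map_mul, hG]
    by_cases h1 : eval c' h = 0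
    · rw [h1, zero_mul]
    · rw [det_functionals_eq_zero (H w hw c' hc' h1), mul_zero]
  rw [map_mul, hG] at h0
  exact mul_ne_zero hh hφ h0

/-- A local generator of `Q'` adjoined to a local frame of `Q` gives seven vectors that are
dependent over the graph, where both fibres are `π²`. They stay dependent at `z`, where the frame is
still independent. -/
theorem IsQuarticBundle.le {f : Fin m → MvPolynomial PIdx K}
    {Q Q' : blowup f → Submodule K (Poly K)} (hQ : IsQuarticBundle f Q)
    (hQ' : IsQuarticBundle f Q') (z : blowup f) : Q' z ≤ Q z := by
  obtain ⟨c, hc⟩ := exists_isCoord z.2.1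
  obtain ⟨h, s, hh, hs⟩ := hQ.1.2 z c hc
  obtain ⟨h', s', hh', hs'⟩ := hQ'.1.2 z c hc
  rw [hs' z c hc hh', Submodule.span_le]
  rintro _ ⟨k, rfl⟩
  have hli : LinearIndependent K fun i => MvPolynomial.map (eval c) (s i) := by
    rw [linearIndependent_iff_card_eq_finrank_span, Set.finrank, ← hs z c hc hh, (hQ.1.1 z).2]
    rfl
  have hcons : ∀ c, (fun j => MvPolynomial.map (eval c) ((Fin.cons (s' k) s : Fin 7 → _) j)) =
      Fin.cons (MvPolynomial.map (eval c) (s' k)) (fun i => MvPolynomial.map (eval c) (s i)) := by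
    intro c
    ext1 j
    refine Fin.cases ?_ (fun j => ?_) j <;> simp
  have key := not_linearIndependent_of_graph (Fin.cons (s' k) s : Fin 7 → _) (h * h') (f := f)
    (fun w hw c hc hne => by
      rw [hcons, linearIndependent_finCons]
      rintro ⟨-, h2⟩
      rw [map_mul] at hne
      let w' : blowup f := ⟨w, graph_subset_blowup f hw⟩
      apply h2
      rw [← hs w' c hc (left_ne_zero_of_mul hne), hQ.2 w' hw.2.1, ← hQ'.2 w' hw.2.1,
        hs' w' c hc (right_ne_zero_of_mul hne)]
      exact Submodule.subset_span ⟨k, rfl⟩) z.2 hc (by rw [map_mul]; exact mul_ne_zero hh hh')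
  rw [hcons, linearIndependent_finCons, not_and, not_not] at key
  rw [hs z c hc hh]
  exact key hli

theorem IsQuarticBundle.unique {f : Fin m → MvPolynomial PIdx K}
    {Q Q' : blowup f → Submodule K (Poly K)} (hQ : IsQuarticBundle f Q)
    (hQ' : IsQuarticBundle f Q') : Q' = Q :=
  funext fun z => le_antisymm (hQ.le hQ' z) (hQ'.le hQ z)

end Coordinates

/-! ### The bundle spanned by limits of elements of `π²` -/

section LimitBundle

variable {K : Type*} [Field K] {m : ℕ}

/-- Families of quartic forms, with coefficients polynomial in the coordinates of the blow-up, that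
lie in `π²` over the nets `π ∈ 𝕏 ∖ 𝔾`. -/
def IsSection (f : Fin m → MvPolynomial PIdx K)
    (s : MvPolynomial (Fin 4) (MvPolynomial (PIdx ⊕ Fin m) K)) : Prop :=
  ∀ w ∈ graph f, ∀ c, IsCoord w c → MvPolynomial.map (eval c) s ∈ w.1 ^ 2

/-- The space of values of the sections at a point of the blow-up. -/
noncomputable def limitBundle (f : Fin m → MvPolynomial PIdx K) (z : Pt K m) :
    Submodule K (Poly K) :=
  Submodule.span K {x | ∃ c, IsCoord z c ∧ ∃ s, IsSection f s ∧ MvPolynomial.map (eval c) s = x}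

theorem IsCoord.scale {z : Pt K m} {c : PIdx ⊕ Fin m → K} (hc : IsCoord z c) {a b : K}
    (ha : a ≠ 0) (hb : b ≠ 0) :
    IsCoord z (Sum.elim (fun s => a * c (Sum.inl s)) (fun i => b * c (Sum.inr i))) := by
  obtain ⟨h1, h2, h3⟩ := hc
  refine ⟨isPlucker_smul h1 ha, smul_ne_zero hb h2, ?_⟩
  rw [h3]
  exact (Projectivization.mk_eq_mk_iff' K _ _ _ _).2 ⟨b⁻¹, by
    ext i
    simp [hb]⟩

/-- Two coordinate vectors of a point differ by a rescaling of each block, and the substitution `θ`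
carrying out this rescaling maps sections to sections. So one coordinate vector suffices. -/
theorem limitBundle_eq (f : Fin m → MvPolynomial PIdx K) {z : Pt K m}
    {c : PIdx ⊕ Fin m → K} (hc : IsCoord z c) : limitBundle f z =
      Submodule.span K {x | ∃ s, IsSection f s ∧ MvPolynomial.map (eval c) s = x} := by
  unfold limitBundle
  congr 1
  ext x
  constructor
  · rintro ⟨c', hc', s, hs, rfl⟩
    obtain ⟨a, b, ha, hb, h1, h2⟩ := hc.exists_scale hc'
    let θ : MvPolynomial (PIdx ⊕ Fin m) K →ₐ[K] MvPolynomial (PIdx ⊕ Fin m) K :=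
      aeval (Sum.elim (fun s => C a * X (Sum.inl s)) (fun i => C b * X (Sum.inr i)))
    have hθ : ∀ c : PIdx ⊕ Fin m → K, (eval c).comp θ.toRingHom =
        eval (Sum.elim (fun s => a * c (Sum.inl s)) (fun i => b * c (Sum.inr i))) := by
      intro c
      refine MvPolynomial.ringHom_ext (fun r => ?_) (fun i => ?_)
      · simp [θ]
      · rcases i with i | i <;> simp [θ]
    refine ⟨MvPolynomial.map θ.toRingHom s, fun w hw c hc => ?_, ?_⟩
    · rw [map_map, hθ]
      exact hs w hw _ (hc.scale ha hb)
    · have h3 : Sum.elim (fun s => a * c (Sum.inl s)) (fun i => b * c (Sum.inr i)) = c' := by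
        ext i
        rcases i with i | i <;> simp [h1, h2]
      rw [map_map, hθ, h3]
  · rintro ⟨s, hs, rfl⟩
    exact ⟨c, hc, s, hs, rfl⟩

theorem sq_le_forms {π : Submodule K (Poly K)} (hπ : π ≤ Forms K 2) : π ^ 2 ≤ Forms K 4 := by
  rw [sq, Submodule.mul_le]
  exact fun x hx y hy => IsHomogeneous.mul (hπ hx) (hπ hy)

/-- The coefficients of a section in degrees other than four vanish on the graph, hence on its
closure. -/
theorem limitBundle_le_forms (f : Fin m → MvPolynomial PIdx K) {z : Pt K m}
    (hz : z ∈ blowup f) : limitBundle f z ≤ Forms K 4 := by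
  refine Submodule.span_le.2 ?_
  rintro _ ⟨c, hc, s, hs, rfl⟩ n hn
  by_contra hne
  apply hn
  rw [coeff_map]
  refine hz.2 _ (fun w hw c' hc' => ?_) c hc
  rw [← coeff_map]
  by_contra h
  exact hne (sq_le_forms (detNets_le_forms hw.1) (hs w hw c' hc') h)

theorem exists_sections (f : Fin m → MvPolynomial PIdx K) {z : Pt K m} (hz : z ∈ blowup f)
    {c : PIdx ⊕ Fin m → K} (hc : IsCoord z c) {n : ℕ} (hn : finrank K (limitBundle f z) = n) :
    ∃ s : Fin n → MvPolynomial (Fin 4) (MvPolynomial (PIdx ⊕ Fin m) K), (∀ i, IsSection f (s i)) ∧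
      LinearIndependent K (fun i => MvPolynomial.map (eval c) (s i)) := by
  have hfin : Module.Finite K (limitBundle f z) :=
    Submodule.finiteDimensional_of_le (limitBundle_le_forms f hz)
  rw [limitBundle_eq f hc] at hfin hn
  obtain ⟨g, hg, -, hli⟩ := Submodule.exists_fun_fin_finrank_span_eq K
    {x | ∃ s, IsSection f s ∧ MvPolynomial.map (eval c) s = x}
  subst hn
  choose s hs hs' using hg
  refine ⟨s, hs, ?_⟩
  simpa only [hs'] using hli

/-- Semicontinuity: more than six sections are dependent over the graph because `π²` is spanned by
six products, so they are dependent everywhere. -/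
theorem finrank_limitBundle_le (f : Fin m → MvPolynomial PIdx K) {z : Pt K m}
    (hz : z ∈ blowup f) : finrank K (limitBundle f z) ≤ 6 := by
  obtain ⟨c, hc⟩ := exists_isCoord hz.1
  obtain ⟨s, hs, hli⟩ := exists_sections f hz hc rfl
  by_contra hlt
  refine not_linearIndependent_of_graph s 1 (fun w hw c hc _ hli' => ?_) hz hc (by simp) hli
  have h1 := finrank_span_eq_card hli'
  have h2 : finrank K (Submodule.span K (Set.range fun i => MvPolynomial.map (eval c) (s i))) ≤
      finrank K ↥(w.1 ^ 2) := by
    refine finrank_mono_of_le_forms (Submodule.span_le.2 ?_)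
      (sq_le_forms (detNets_le_forms hw.1))
    rintro _ ⟨i, rfl⟩
    exact hs i w hw c hc
  rw [h1, Fintype.card_fin] at h2
  exact hlt (h2.trans (finrank_sq_le hw.1))

/-- Products of two Cramer forms are sections, and at a point where the chosen Plücker coordinate is
nonzero they span the square of the net. -/
theorem sq_le_limitBundle (f : Fin m → MvPolynomial PIdx K) {z : Pt K m}
    (hz : z ∈ blowup f) : z.1 ^ 2 ≤ limitBundle f z := by
  obtain ⟨c, hc⟩ := exists_isCoord hz.1
  obtain ⟨t, ht⟩ := hc.1.exists_ne_zero (detNets_le_forms hz.1)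
  have h1 := span_cramerForm (detNets_le_forms hz.1) hc.1 ht
  rw [limitBundle_eq f hc]
  conv_lhs => rw [← h1, sq, Submodule.span_mul_span]
  refine Submodule.span_le.2 ?_
  rintro _ ⟨_, ⟨i, rfl⟩, _, ⟨j, rfl⟩, rfl⟩
  let B : Fin 3 → MvPolynomial (Fin 4) (MvPolynomial (PIdx ⊕ Fin m) K) :=
    cramerForm (fun i => X (Sum.inl i)) t
  refine Submodule.subset_span ⟨B i * B j, fun w hw c' hc' => ?_, ?_⟩
  · simp only [map_mul, B, map_cramerForm, eval_X]
    rw [sq]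
    exact Submodule.mul_mem_mul (cramerForm_mem (detNets_le_forms hw.1) hc'.1 _ _)
      (cramerForm_mem (detNets_le_forms hw.1) hc'.1 _ _)
  · simp only [map_mul, B, map_cramerForm, eval_X]

/-- Once the rank is six everywhere, six sections independent at one point form a frame wherever a
determinant `G` is nonzero. Only the lower bound over `𝔾` needs local analysis. -/
theorem isQuarticBundle_limitBundle [IsAlgClosed K] [CharZero K] {f : Fin m → MvPolynomial PIdx K}
    (h6 : ∀ z ∈ blowup f, z.1 ∈ squareNets K → 6 ≤ finrank K (limitBundle f z)) :
    IsQuarticBundle f fun z => limitBundle f z := by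
  have hrank : ∀ z : blowup f, finrank K (limitBundle f z) = 6 := by
    intro z
    refine le_antisymm (finrank_limitBundle_le f z.2) ?_
    by_cases hz : z.1.1 ∈ squareNets K
    · exact h6 z z.2 hz
    · rw [← finrank_sq_eq z.2.1 hz]
      exact finrank_mono_of_le_forms (sq_le_limitBundle f z.2) (limitBundle_le_forms f z.2)
  refine ⟨⟨fun z => ⟨limitBundle_le_forms f z.2, hrank z⟩, fun z₀ c₀ hc₀ => ?_⟩, fun z hz => ?_⟩
  · obtain ⟨s, hs, hli⟩ := exists_sections f z₀.2 hc₀ (hrank z₀)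
    obtain ⟨φ, hφ⟩ := exists_functionals_det_ne_zero hli
    obtain ⟨G, hG⟩ := exists_eval_eq_det φ s
    refine ⟨G, s, by rwa [hG], fun z c hc hne => ?_⟩
    have hli' : LinearIndependent K fun i => MvPolynomial.map (eval c) (s i) := by
      by_contra h
      exact hne (by rw [hG, det_functionals_eq_zero h])
    symm
    refine eq_of_le_of_finrank_ge_of_le_forms ?_ (limitBundle_le_forms f z.2) ?_
    · rw [Submodule.span_le]
      rintro _ ⟨i, rfl⟩
      exact Submodule.subset_span ⟨c, hc, s i, hs i, rfl⟩
    · rw [hrank z, finrank_span_eq_card hli', Fintype.card_fin]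
  · symm
    refine eq_of_le_of_finrank_ge_of_le_forms (sq_le_limitBundle f z.2)
      (limitBundle_le_forms f z.2) ?_
    rw [hrank z, finrank_sq_eq z.2.1 hz]

end LimitBundle

/-! ### Affine charts around the squares of lines -/

section Chart

variable {R S : Type*} [CommRing R] [CommRing S]

/-- The linear form with coefficients `a` in the permuted homogeneous coordinates. -/
noncomputable def linForm (σ : Equiv.Perm (Fin 4)) (a : Fin 4 → R) : MvPolynomial (Fin 4) R :=
  ∑ i, C (a i) * X (σ i)

theorem linForm_apply (σ : Equiv.Perm (Fin 4)) (a : Fin 4 → R) : linForm σ a =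
    C (a 0) * X (σ 0) + C (a 1) * X (σ 1) + C (a 2) * X (σ 2) + C (a 3) * X (σ 3) :=
  Fin.sum_univ_four _

theorem linForm_mem (σ : Equiv.Perm (Fin 4)) {K : Type*} [Field K] (a : Fin 4 → K) :
    linForm σ a ∈ Forms K 1 :=
  sum_mem fun i _ => isHomogeneous_C_mul_X (a i) (σ i)

theorem exists_linForm (σ : Equiv.Perm (Fin 4)) {K : Type*} [Field K] {l : Poly K}
    (hl : l ∈ Forms K 1) : ∃ a, l = linForm σ a := by
  change l ∈ homogeneousSubmodule (Fin 4) K 1 at hl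
  rw [homogeneousSubmodule_one_eq_span_X] at hl
  obtain ⟨c, hc⟩ := (Submodule.mem_span_range_iff_exists_fun K).1 hl
  refine ⟨c ∘ σ, ?_⟩
  rw [← hc, ← Equiv.sum_comp σ]
  simp [linForm, smul_eq_C_mul]

theorem map_linForm (φ : R →+* S) (σ : Equiv.Perm (Fin 4)) (a : Fin 4 → R) :
    MvPolynomial.map φ (linForm σ a) = linForm σ (φ ∘ a) := by
  simp [linForm]

theorem eval_linForm (σ : Equiv.Perm (Fin 4)) (a x : Fin 4 → R) :
    eval x (linForm σ a) = ∑ i, a i * x (σ i) := by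
  simp [linForm]

/-- The quadratic monomial `x_i x_j`. -/
noncomputable def quadMon (i j : Fin 4) : QuadMon :=
  ⟨Finsupp.single i 1 + Finsupp.single j 1, by simp⟩

theorem coeff_linForm_mul (σ : Equiv.Perm (Fin 4)) (a b : Fin 4 → R) (i j : Fin 4) :
    coeff (quadMon (σ i) (σ j)).1 (linForm σ a * linForm σ b) =
      if i = j then a i * b i else a i * b j + a j * b i := by
  have h : ∀ k l, coeff (quadMon (σ i) (σ j)).1 (C (a k) * X (σ k) * (C (b l) * X (σ l))) =
      if (k = i ∧ l = j) ∨ (k = j ∧ l = i) then a k * b l else 0 := by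
    intro k l
    have h1 : C (a k) * X (σ k) * (C (b l) * X (σ l)) = monomial
        (Finsupp.single (σ k) 1 + Finsupp.single (σ l) 1) (a k * b l) := by
      rw [← monomial_mul, C_mul_X_eq_monomial, C_mul_X_eq_monomial]
    rw [h1, coeff_monomial]
    simp only [quadMon, Finsupp.single_add_single_eq_single_add_single one_ne_zero one_ne_zero,
      σ.injective.eq_iff, true_and]
    simp
  simp only [linForm, Finset.sum_mul_sum, coeff_sum, h]
  fin_cases i <;> fin_cases j <;> simp [Fin.sum_univ_four] <;> ring

/-- Parameters of the charts of the variety of determinantal nets: the first four are parameters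
of a line, the other eight are normal to the subvariety of squares of lines. -/
abbrev Par : Type := (Fin 2 × Fin 2) ⊕ (Fin 4 × Fin 2)

/-- The first linear form of the line. -/
noncomputable def lineForm (σ : Equiv.Perm (Fin 4)) (v : Par → R) : MvPolynomial (Fin 4) R :=
  linForm σ ![1, 0, v (Sum.inl (0, 0)), v (Sum.inl (0, 1))]

/-- The second linear form of the line. -/
noncomputable def lineForm' (σ : Equiv.Perm (Fin 4)) (v : Par → R) : MvPolynomial (Fin 4) R :=
  linForm σ ![0, 1, v (Sum.inl (1, 0)), v (Sum.inl (1, 1))]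

/-- The perturbing linear forms. -/
noncomputable def normalForm (σ : Equiv.Perm (Fin 4)) (v : Par → R) (k : Fin 4) :
    MvPolynomial (Fin 4) R :=
  linForm σ ![0, 0, v (Sum.inr (k, 0)), v (Sum.inr (k, 1))]

/-- The quadratic forms that span the net with parameters `v`. -/
noncomputable def quads (σ : Equiv.Perm (Fin 4)) (v : Par → R) :
    Fin 3 → MvPolynomial (Fin 4) R :=
  ![lineForm' σ v * (lineForm' σ v + normalForm σ v 3) -
      normalForm σ v 2 * (lineForm σ v + normalForm σ v 1),
    normalForm σ v 2 * normalForm σ v 0 + lineForm σ v * (lineForm' σ v + normalForm σ v 3),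
    lineForm σ v * (lineForm σ v + normalForm σ v 1) + lineForm' σ v * normalForm σ v 0]

theorem map_lineForm (φ : R →+* S) (σ : Equiv.Perm (Fin 4)) (v : Par → R) :
    MvPolynomial.map φ (lineForm σ v) = lineForm σ (fun k => φ (v k)) := by
  rw [lineForm, map_linForm, lineForm]
  congr 1
  ext i
  fin_cases i <;> simp

theorem map_lineForm' (φ : R →+* S) (σ : Equiv.Perm (Fin 4)) (v : Par → R) :
    MvPolynomial.map φ (lineForm' σ v) = lineForm' σ (fun k => φ (v k)) := by
  rw [lineForm', map_linForm, lineForm']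
  congr 1
  ext i
  fin_cases i <;> simp

theorem map_normalForm (φ : R →+* S) (σ : Equiv.Perm (Fin 4)) (v : Par → R) (k : Fin 4) :
    MvPolynomial.map φ (normalForm σ v k) = normalForm σ (fun k => φ (v k)) k := by
  rw [normalForm, map_linForm, normalForm]
  congr 1
  ext i
  fin_cases i <;> simp

theorem map_quads (φ : R →+* S) (σ : Equiv.Perm (Fin 4)) (v : Par → R) (i : Fin 3) :
    MvPolynomial.map φ (quads σ v i) = quads σ (fun k => φ (v k)) i := by
  fin_cases i <;> simp [quads, map_lineForm, map_lineForm', map_normalForm]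

/-- The Plücker coordinate that does not vanish on the chart. -/
noncomputable def baseIdx (σ : Equiv.Perm (Fin 4)) : PIdx :=
  ![quadMon (σ 1) (σ 1), quadMon (σ 0) (σ 1), quadMon (σ 0) (σ 0)]

/-- The perturbing forms do not involve `X (σ 0)` and `X (σ 1)`, so modulo the other two variables
the quadrics are the fixed monomials of `baseIdx`. -/
theorem coeff_quads_baseIdx (σ : Equiv.Perm (Fin 4)) (v : Par → R) (i j : Fin 3) :
    coeff (baseIdx σ j).1 (quads σ v i) = if i = j then 1 else 0 := by
  fin_cases i <;> fin_cases j <;>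
    simp [quads, baseIdx, lineForm, lineForm', normalForm, mul_add, coeff_linForm_mul]

/-- Plücker coordinates of the net with parameters `v`. -/
noncomputable def chartPlucker (σ : Equiv.Perm (Fin 4)) (v : Par → R) (s : PIdx) : R :=
  (Matrix.of fun i j : Fin 3 => coeff (s j).1 (quads σ v i)).det

theorem map_chartPlucker (φ : R →+* S) (σ : Equiv.Perm (Fin 4)) (v : Par → R) (s : PIdx) :
    φ (chartPlucker σ v s) = chartPlucker σ (fun k => φ (v k)) s := by
  rw [chartPlucker, RingHom.map_det, chartPlucker]
  congr 1
  ext i j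
  simp [← map_quads, coeff_map]

theorem of_coeff_quads_baseIdx (σ : Equiv.Perm (Fin 4)) (v : Par → R) :
    (Matrix.of fun i j : Fin 3 => coeff (baseIdx σ j).1 (quads σ v i)) = 1 := by
  ext i j
  simp [coeff_quads_baseIdx, Matrix.one_apply]

theorem chartPlucker_baseIdx (σ : Equiv.Perm (Fin 4)) (v : Par → R) :
    chartPlucker σ v (baseIdx σ) = 1 := by
  rw [chartPlucker, of_coeff_quads_baseIdx, Matrix.det_one]

theorem chartPlucker_update (σ : Equiv.Perm (Fin 4)) (v : Par → R) (j : Fin 3) (n : QuadMon) :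
    chartPlucker σ v (Function.update (baseIdx σ) j n) = coeff n.1 (quads σ v j) := by
  have h2 : (Matrix.of fun i k : Fin 3 => coeff (Function.update (baseIdx σ) j n k).1
      (quads σ v i)) = (1 : Matrix (Fin 3) (Fin 3) R).updateCol j
        (fun i => coeff n.1 (quads σ v i)) := by
    rw [← of_coeff_quads_baseIdx σ v]
    ext i k
    by_cases hk : k = j
    · subst hk; simp
    · simp [hk]
  rw [chartPlucker, h2, ← Matrix.cramer_apply, Matrix.cramer_one]
  rfl

end Chart

/-! ### Chart parameters as functions of the Plücker coordinates -/

section ChartInverse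

variable {K : Type*} [Field K]

/-- The net with parameters `v`. -/
noncomputable def chartNet (σ : Equiv.Perm (Fin 4)) (v : Par → K) : Submodule K (Poly K) :=
  Submodule.span K (Set.range (quads σ v))

theorem linearIndependent_of_coeff {q : Fin 3 → Poly K} {s : PIdx}
    (h : (Matrix.of fun i j : Fin 3 => coeff (s j).1 (q i)).det ≠ 0) : LinearIndependent K q := by
  rw [Fintype.linearIndependent_iff]
  intro g hg
  by_contra hne
  push Not at hne
  obtain ⟨i, hi⟩ := hne
  refine h (Matrix.exists_vecMul_eq_zero_iff.1 ⟨g, fun h => hi (congrFun h i), ?_⟩)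
  ext j
  have := congrArg (coeff (s j).1) hg
  simpa [coeff_sum, Matrix.vecMul, dotProduct] using this

theorem linearIndependent_quads (σ : Equiv.Perm (Fin 4)) (v : Par → K) :
    LinearIndependent K (quads σ v) :=
  linearIndependent_of_coeff (s := baseIdx σ) (by simp [of_coeff_quads_baseIdx])

theorem isPlucker_chartNet (σ : Equiv.Perm (Fin 4)) (v : Par → K) :
    IsPlucker (chartNet σ v) (chartPlucker σ v) :=
  ⟨_, linearIndependent_quads σ v, rfl, rfl⟩

theorem eq_smul_chartPlucker (σ : Equiv.Perm (Fin 4)) {v : Par → K} {p : PIdx → K}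
    (hp : IsPlucker (chartNet σ v) p) : p = p (baseIdx σ) • chartPlucker σ v := by
  obtain ⟨t, -, ht⟩ := (isPlucker_chartNet σ v).exists_smul hp
  have := congrFun ht (baseIdx σ)
  rw [Pi.smul_apply, chartPlucker_baseIdx, smul_eq_mul, mul_one] at this
  rw [this, ← ht]

theorem chartNet_mem_detNets (σ : Equiv.Perm (Fin 4)) (v : Par → K) :
    chartNet σ v ∈ detNets K := by
  refine ⟨?_, !![lineForm σ v, normalForm σ v 0; -lineForm' σ v, lineForm σ v + normalForm σ v 1;
    normalForm σ v 2, -(lineForm' σ v + normalForm σ v 3)], ?_, ?_⟩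
  · exact finrank_span_eq_card (linearIndependent_quads σ v)
  · intro i j
    have h1 : lineForm σ v ∈ Forms K 1 := linForm_mem _ _
    have h2 : lineForm' σ v ∈ Forms K 1 := linForm_mem _ _
    have h3 : ∀ k, normalForm σ v k ∈ Forms K 1 := fun k => linForm_mem _ _
    fin_cases i <;> fin_cases j
    · exact h1
    · exact h3 0
    · exact neg_mem h2
    · exact add_mem h1 (h3 1)
    · exact h3 2
    · exact neg_mem (add_mem h2 (h3 3))
  · set A : Matrix (Fin 3) (Fin 2) (Poly K) := !![lineForm σ v, normalForm σ v 0;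
      -lineForm' σ v, lineForm σ v + normalForm σ v 1;
      normalForm σ v 2, -(lineForm' σ v + normalForm σ v 3)] with hA
    have h0 : minors A 0 = quads σ v 0 := by
      simp [minors, Matrix.det_fin_two, quads, hA]; ring
    have h1 : minors A 1 = -quads σ v 1 := by
      simp [minors, Matrix.det_fin_two, quads, hA, Fin.succAbove]; ring
    have h2 : minors A 2 = quads σ v 2 := by
      simp [minors, Matrix.det_fin_two, quads, hA, Fin.succAbove]; ring
    apply le_antisymm <;> refine Submodule.span_le.2 ?_ <;> rintro _ ⟨i, rfl⟩
    · fin_cases i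
      · exact Submodule.subset_span ⟨0, h0⟩
      · exact neg_mem_iff.1 (h1 ▸ Submodule.subset_span ⟨1, rfl⟩)
      · exact Submodule.subset_span ⟨2, h2⟩
    · fin_cases i
      · exact Submodule.subset_span ⟨0, h0.symm⟩
      · exact neg_mem_iff.1 (Submodule.subset_span ⟨1, by simp [h1]⟩)
      · exact Submodule.subset_span ⟨2, h2.symm⟩

/-- The linear form in the Plücker coordinates that recovers a parameter. -/
noncomputable def chartCoord (K : Type*) [Field K] (σ : Equiv.Perm (Fin 4)) :
    Par → MvPolynomial PIdx K :=
  let e (j : Fin 3) (a b : Fin 4) : MvPolynomial PIdx K :=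
    X (Function.update (baseIdx σ) j (quadMon (σ a) (σ b)))
  Sum.elim
    -- `e j a b` reads off a coefficient of the `j`-th quadric. For instance `e 0 1` gives twice a
    -- coefficient of `H'` plus one of `P 3`, and `e 1 0` gives their plain sum, so suitable
    -- differences isolate each of them.
    (fun k => ![e 1 1 (Fin.natAdd 2 k.2), e 0 1 (Fin.natAdd 2 k.2) - e 1 0 (Fin.natAdd 2 k.2)] k.1)
    (fun k => ![e 2 1 (Fin.natAdd 2 k.2),
      e 2 0 (Fin.natAdd 2 k.2) - C 2 * e 1 1 (Fin.natAdd 2 k.2), -e 0 0 (Fin.natAdd 2 k.2),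
      C 2 * e 1 0 (Fin.natAdd 2 k.2) - e 0 1 (Fin.natAdd 2 k.2)] k.1)

theorem eval_chartCoord (σ : Equiv.Perm (Fin 4)) (a : K) (v : Par → K) (k : Par) :
    eval (a • chartPlucker σ v) (chartCoord K σ k) = a * v k := by
  rcases k with ⟨i, j⟩ | ⟨i, j⟩ <;> fin_cases i <;> fin_cases j <;>
    simp [chartCoord, chartPlucker_update, quads, lineForm, lineForm', normalForm, mul_add,
      coeff_linForm_mul] <;> ring

/-- Homogenisation, with the base Plücker coordinate as the extra variable. Every large exponent is
allowed so that several polynomials can be lifted with a common one. -/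
theorem exists_homogeneous_lift (σ : Equiv.Perm (Fin 4)) (g : MvPolynomial Par K) :
    ∃ D₀, ∀ D ≥ D₀, ∃ G : MvPolynomial PIdx K, ∀ (a : K) (v : Par → K),
      eval (a • chartPlucker σ v) G = a ^ D * eval v g := by
  induction g using MvPolynomial.induction_on with
  | C r => exact ⟨0, fun D _ => ⟨C r * X (baseIdx σ) ^ D, fun a v => by
      simp [chartPlucker_baseIdx, mul_comm]⟩⟩
  | add p q hp hq =>
    obtain ⟨D₁, h₁⟩ := hp
    obtain ⟨D₂, h₂⟩ := hq
    refine ⟨max D₁ D₂, fun D hD => ?_⟩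
    obtain ⟨G₁, hG₁⟩ := h₁ D (le_trans (le_max_left _ _) hD)
    obtain ⟨G₂, hG₂⟩ := h₂ D (le_trans (le_max_right _ _) hD)
    exact ⟨G₁ + G₂, fun a v => by rw [map_add, map_add, hG₁, hG₂, mul_add]⟩
  | mul_X p k hp =>
    obtain ⟨D₁, h₁⟩ := hp
    refine ⟨D₁ + 1, fun D hD => ?_⟩
    obtain ⟨G₁, hG₁⟩ := h₁ (D - 1) (by omega)
    refine ⟨G₁ * chartCoord K σ k, fun a v => ?_⟩
    obtain ⟨E, rfl⟩ : ∃ E, D = E + 1 := ⟨D - 1, by omega⟩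
    rw [map_mul, map_mul, hG₁, eval_chartCoord, eval_X, Nat.add_sub_cancel]
    ring

theorem exists_homogeneous_lift_form (σ : Equiv.Perm (Fin 4))
    (T : MvPolynomial (Fin 4) (MvPolynomial Par K)) :
    ∃ D₀, ∀ D ≥ D₀, ∃ T' : MvPolynomial (Fin 4) (MvPolynomial PIdx K),
      ∀ (a : K) (v : Par → K), MvPolynomial.map (eval (a • chartPlucker σ v)) T' =
        C (a ^ D) * MvPolynomial.map (eval v) T := by
  induction T using MvPolynomial.induction_on with
  | C r =>
    obtain ⟨D₀, h⟩ := exists_homogeneous_lift σ r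
    refine ⟨D₀, fun D hD => ?_⟩
    obtain ⟨G, hG⟩ := h D hD
    exact ⟨C G, fun a v => by rw [map_C, map_C, hG, map_mul]⟩
  | add p q hp hq =>
    obtain ⟨D₁, h₁⟩ := hp
    obtain ⟨D₂, h₂⟩ := hq
    refine ⟨max D₁ D₂, fun D hD => ?_⟩
    obtain ⟨G₁, hG₁⟩ := h₁ D (le_trans (le_max_left _ _) hD)
    obtain ⟨G₂, hG₂⟩ := h₂ D (le_trans (le_max_right _ _) hD)
    exact ⟨G₁ + G₂, fun a v => by rw [map_add, map_add, hG₁, hG₂, mul_add]⟩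
  | mul_X p k hp =>
    obtain ⟨D₁, h₁⟩ := hp
    refine ⟨D₁, fun D hD => ?_⟩
    obtain ⟨G₁, hG₁⟩ := h₁ D hD
    exact ⟨G₁ * X k, fun a v => by rw [map_mul, map_mul, hG₁, map_X, map_X, mul_assoc]⟩

end ChartInverse

/-! ### The charts cover the open sets where a base Plücker coordinate is nonzero -/

section Cover

variable {K : Type*} [Field K]

/-- Each column is orthogonal to the cross product. The coefficients of cubic monomials in the first
two variables in these two syzygies fix the shape of the columns in those variables; an invertible
column operation then yields the chart matrix. -/
theorem exists_quads_eq (σ : Equiv.Perm (Fin 4)) {x y : Fin 3 → Fin 4 → K} {D : K} (hD : D ≠ 0)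
    (h : ∀ i j, coeff (baseIdx σ j).1 (crossProduct (fun i => linForm σ (x i))
      (fun i => linForm σ (y i)) i) = if i = j then D else 0) :
    ∃ v, ∀ i, C D * quads σ v i =
      crossProduct (fun i => linForm σ (x i)) (fun i => linForm σ (y i)) i := by
  have e00 := h 0 0
  have e01 := h 0 1
  have e02 := h 0 2
  have e10 := h 1 0
  have e11 := h 1 1
  have e12 := h 1 2
  have e20 := h 2 0
  have e21 := h 2 1
  have e22 := h 2 2
  simp [cross_apply, baseIdx, coeff_linForm_mul] at e00 e01 e02 e10 e11 e12 e20 e21 e22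
  have x01 : x 0 1 = 0 := by
    refine (mul_eq_zero.1 (?_ : D * x 0 1 = 0)).resolve_left hD
    linear_combination -x 0 1 * e00 - x 1 1 * e10 - x 2 1 * e20
  have y01 : y 0 1 = 0 := by
    refine (mul_eq_zero.1 (?_ : D * y 0 1 = 0)).resolve_left hD
    linear_combination -y 0 1 * e00 - y 1 1 * e10 - y 2 1 * e20
  have x20 : x 2 0 = 0 := by
    refine (mul_eq_zero.1 (?_ : D * x 2 0 = 0)).resolve_left hD
    linear_combination -x 0 0 * e02 - x 1 0 * e12 - x 2 0 * e22
  have y20 : y 2 0 = 0 := by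
    refine (mul_eq_zero.1 (?_ : D * y 2 0 = 0)).resolve_left hD
    linear_combination -y 0 0 * e02 - y 1 0 * e12 - y 2 0 * e22
  have x11 : x 1 1 = - x 0 0 := by
    refine mul_left_cancel₀ hD ?_
    linear_combination -x 0 0 * e00 - x 1 0 * e10 - x 2 0 * e20 -
      x 0 1 * e01 - x 1 1 * e11 - x 2 1 * e21
  have y11 : y 1 1 = - y 0 0 := by
    refine mul_left_cancel₀ hD ?_
    linear_combination -y 0 0 * e00 - y 1 0 * e10 - y 2 0 * e20 -
      y 0 1 * e01 - y 1 1 * e11 - y 2 1 * e21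
  have x21 : x 2 1 = - x 1 0 := by
    refine mul_left_cancel₀ hD ?_
    linear_combination -x 0 0 * e01 - x 1 0 * e11 - x 2 0 * e21 -
      x 0 1 * e02 - x 1 1 * e12 - x 2 1 * e22
  have y21 : y 2 1 = - y 1 0 := by
    refine mul_left_cancel₀ hD ?_
    linear_combination -y 0 0 * e01 - y 1 0 * e11 - y 2 0 * e21 -
      y 0 1 * e02 - y 1 1 * e12 - y 2 1 * e22
  have hdet : x 0 0 * y 1 0 - x 1 0 * y 0 0 = D := by
    rw [← e22]
  -- The column operation inverts the `2 × 2` block of coefficients of `X (σ 0)` in the first two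
  -- rows, whose determinant is `D` by `hdet`.
  let x' : Fin 3 → Fin 4 → K := fun j i => D⁻¹ * (y 1 0 * x j i - x 1 0 * y j i)
  let y' : Fin 3 → Fin 4 → K := fun j i => D⁻¹ * (x 0 0 * y j i - y 0 0 * x j i)
  have hx : ∀ j, linForm σ (x' j) =
      C D⁻¹ * (C (y 1 0) * linForm σ (x j) - C (x 1 0) * linForm σ (y j)) := by
    intro j
    simp only [linForm_apply, x', map_mul, map_sub]
    ring
  have hy : ∀ j, linForm σ (y' j) =
      C D⁻¹ * (C (x 0 0) * linForm σ (y j) - C (y 0 0) * linForm σ (x j)) := by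
    intro j
    simp only [linForm_apply, y', map_mul, map_sub]
    ring
  let v : Par → K := Sum.elim
    (fun k => ![x' 0 (Fin.natAdd 2 k.2), -x' 1 (Fin.natAdd 2 k.2)] k.1)
    (fun k => ![y' 0 (Fin.natAdd 2 k.2), y' 1 (Fin.natAdd 2 k.2) - x' 0 (Fin.natAdd 2 k.2),
      x' 2 (Fin.natAdd 2 k.2), -y' 2 (Fin.natAdd 2 k.2) + x' 1 (Fin.natAdd 2 k.2)] k.1)
  have d1 : D⁻¹ * D = 1 := inv_mul_cancel₀ hD
  have hx00 : x' 0 0 = 1 := by simp only [x']; rw [← d1, ← hdet]; ring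
  have hx01 : x' 0 1 = 0 := by simp only [x', x01, y01]; ring
  have hx10 : x' 1 0 = 0 := by simp only [x']; ring
  have hx11 : x' 1 1 = -1 := by simp only [x', x11, y11]; rw [← d1, ← hdet]; ring
  have hx20 : x' 2 0 = 0 := by simp only [x', x20, y20]; ring
  have hx21 : x' 2 1 = 0 := by simp only [x', x21, y21]; ring
  have hy00 : y' 0 0 = 0 := by simp only [y']; ring
  have hy01 : y' 0 1 = 0 := by simp only [y', x01, y01]; ring
  have hy10 : y' 1 0 = 1 := by simp only [y']; rw [← d1, ← hdet]; ring
  have hy11 : y' 1 1 = 0 := by simp only [y', x11, y11]; ring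
  have hy20 : y' 2 0 = 0 := by simp only [y', x20, y20]; ring
  have hy21 : y' 2 1 = -1 := by simp only [y', x21, y21]; rw [← d1, ← hdet]; ring
  have a0 : lineForm σ v = linForm σ (x' 0) := by
    simp [lineForm, linForm_apply, v, hx00, hx01]
  have a1 : lineForm' σ v = -linForm σ (x' 1) := by
    simp [lineForm', linForm_apply, v, hx10, hx11]; ring
  have a2 : normalForm σ v 2 = linForm σ (x' 2) := by
    simp [normalForm, linForm_apply, v, hx20, hx21]
  have b0 : normalForm σ v 0 = linForm σ (y' 0) := by
    simp [normalForm, linForm_apply, v, hy00, hy01]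
  have b1 : normalForm σ v 1 = linForm σ (y' 1) - linForm σ (x' 0) := by
    simp [normalForm, linForm_apply, v, hy10, hy11, hx00, hx01]; ring
  have b2 : normalForm σ v 3 = -linForm σ (y' 2) + linForm σ (x' 1) := by
    simp [normalForm, linForm_apply, v, hy20, hy21, hx10, hx11]; ring
  have hdet' : (C D⁻¹ : Poly K) * (C (x 0 0) * C (y 1 0) - C (x 1 0) * C (y 0 0)) = 1 := by
    simp only [← map_mul, ← map_sub, hdet, d1, map_one]
  have hDD : (C D : Poly K) * C D⁻¹ = 1 := by
    rw [← map_mul, mul_inv_cancel₀ hD, map_one]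
  refine ⟨v, fun i => ?_⟩
  fin_cases i
  · simp only [quads, cross_apply, a0, a1, a2, b0, b1, b2, hx, hy, Fin.zero_eta, Matrix.cons_val]
    linear_combination (linForm σ (x 1) * linForm σ (y 2) - linForm σ (x 2) * linForm σ (y 1)) *
      (C D * C D⁻¹ * hdet' + hDD)
  · simp only [quads, cross_apply, a0, a1, a2, b0, b1, b2, hx, hy, Fin.mk_one, Matrix.cons_val]
    linear_combination (linForm σ (x 2) * linForm σ (y 0) - linForm σ (x 0) * linForm σ (y 2)) *
      (C D * C D⁻¹ * hdet' + hDD)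
  · simp only [quads, cross_apply, a0, a1, a2, b0, b1, b2, hx, hy, Fin.reduceFinMk, Matrix.cons_val]
    linear_combination (linForm σ (x 0) * linForm σ (y 1) - linForm σ (x 1) * linForm σ (y 0)) *
      (C D * C D⁻¹ * hdet' + hDD)

theorem crossProduct_transpose_mulVec {R : Type*} [CommRing R] (M : Matrix (Fin 3) (Fin 3) R)
    (a b : Fin 3 → R) : crossProduct (M.transpose.mulVec a) (M.transpose.mulVec b) =
      M.adjugate.mulVec (crossProduct a b) := by
  ext i
  fin_cases i <;>
    simp [cross_apply, Matrix.adjugate_fin_three, Matrix.mulVec, dotProduct, Fin.sum_univ_three] <;>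
    ring

/-- Let `M` hold the base coefficients of the minors. Multiplying the matrix on the left by
`M.transpose` multiplies the vector of minors by `M.adjugate`, so the new base coefficients are
`M.det` times the identity and `exists_quads_eq` applies. -/
theorem exists_chart (σ : Equiv.Perm (Fin 4)) {π : Submodule K (Poly K)} (hπ : π ∈ detNets K)
    {p : PIdx → K} (hp : IsPlucker π p) (h0 : p (baseIdx σ) ≠ 0) :
    ∃ v, π = chartNet σ v ∧ p = p (baseIdx σ) • chartPlucker σ v := by
  suffices h : ∃ v, π = chartNet σ v by
    obtain ⟨v, rfl⟩ := h
    exact ⟨v, rfl, eq_smul_chartPlucker σ hp⟩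
  obtain ⟨h3, A, hA, rfl⟩ := hπ
  choose b hb using fun i j => exists_linForm σ (hA i j)
  set a₀ : Fin 3 → Poly K := fun i => A i 0
  set a₁ : Fin 3 → Poly K := fun i => A i 1
  set n := crossProduct a₀ a₁ with hn
  have hspan : Submodule.span K (Set.range n) = Submodule.span K (Set.range (minors A)) := by
    have h0 : n 0 = minors A 0 := by
      simp [minors, Matrix.det_fin_two, hn, cross_apply, a₀, a₁]; ring
    have h1 : n 1 = -minors A 1 := by
      simp [minors, Matrix.det_fin_two, hn, cross_apply, a₀, a₁, Fin.succAbove]; ring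
    have h2 : n 2 = minors A 2 := by
      simp [minors, Matrix.det_fin_two, hn, cross_apply, a₀, a₁, Fin.succAbove]; ring
    apply le_antisymm <;> refine Submodule.span_le.2 ?_ <;> rintro _ ⟨i, rfl⟩
    · fin_cases i
      · exact Submodule.subset_span ⟨0, h0.symm⟩
      · exact neg_mem_iff.1 (Submodule.subset_span ⟨1, by simp [h1]⟩)
      · exact Submodule.subset_span ⟨2, h2.symm⟩
    · fin_cases i
      · exact Submodule.subset_span ⟨0, h0⟩
      · exact neg_mem_iff.1 (h1 ▸ Submodule.subset_span ⟨1, rfl⟩)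
      · exact Submodule.subset_span ⟨2, h2⟩
  have hli : LinearIndependent K n := by
    rw [linearIndependent_iff_card_eq_finrank_span, Set.finrank, hspan, h3]
    rfl
  rw [← hspan] at hp ⊢
  obtain ⟨t, ht, hpt⟩ := hp.exists_smul (p' := plucker n) ⟨n, hli, rfl, rfl⟩
  set M : Matrix (Fin 3) (Fin 3) K := Matrix.of fun i j => coeff (baseIdx σ j).1 (n i) with hM
  have hD : M.det ≠ 0 := by
    have : plucker n (baseIdx σ) = t * p (baseIdx σ) := congrFun hpt _
    change plucker n (baseIdx σ) ≠ 0
    rw [this]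
    exact mul_ne_zero ht h0
  let N : Matrix (Fin 3) (Fin 3) (Poly K) := M.map C
  let x : Fin 3 → Fin 4 → K := fun j k => ∑ i, M i j * b i 0 k
  let y : Fin 3 → Fin 4 → K := fun j k => ∑ i, M i j * b i 1 k
  have hx : (fun j => linForm σ (x j)) = N.transpose.mulVec a₀ := by
    ext1 j
    simp only [Matrix.mulVec, dotProduct, Fin.sum_univ_three, a₀, hb, linForm_apply, x, N,
      Matrix.transpose_apply, Matrix.map_apply, map_add, map_mul]
    ring
  have hy : (fun j => linForm σ (y j)) = N.transpose.mulVec a₁ := by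
    ext1 j
    simp only [Matrix.mulVec, dotProduct, Fin.sum_univ_three, a₁, hb, linForm_apply, y, N,
      Matrix.transpose_apply, Matrix.map_apply, map_add, map_mul]
    ring
  have hN : ∀ i, N.adjugate.mulVec n i = ∑ j, M.adjugate i j • n j := by
    intro i
    have : N.adjugate = M.adjugate.map C := (RingHom.map_adjugate C M).symm
    simp [this, Matrix.mulVec, dotProduct, smul_eq_C_mul]
  have hcross : ∀ i, crossProduct (fun i => linForm σ (x i)) (fun i => linForm σ (y i)) i =
      ∑ j, M.adjugate i j • n j := by
    intro i
    rw [hx, hy, crossProduct_transpose_mulVec, ← hn, hN]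
  obtain ⟨v, hv⟩ := exists_quads_eq σ (x := x) (y := y) hD (by
    intro i j
    rw [hcross]
    have := congrFun (congrFun M.adjugate_mul i) j
    simpa [Matrix.mul_apply, Matrix.one_apply, coeff_sum, hM] using this)
  refine ⟨v, ?_⟩
  have hle : chartNet σ v ≤ Submodule.span K (Set.range n) := by
    refine Submodule.span_le.2 ?_
    rintro _ ⟨i, rfl⟩
    have h1 : quads σ v i = M.det⁻¹ • ∑ j, M.adjugate i j • n j := by
      rw [← hcross, ← hv, smul_eq_C_mul, ← mul_assoc, ← map_mul, inv_mul_cancel₀ hD, map_one,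
        one_mul]
    rw [h1]
    exact Submodule.smul_mem _ _ (sum_mem fun j _ => Submodule.smul_mem _ _
      (Submodule.subset_span ⟨j, rfl⟩))
  have hfin : Module.Finite K (Submodule.span K (Set.range n)) :=
    Module.Finite.span_of_finite K (Set.finite_range n)
  refine (Submodule.eq_of_le_of_finrank_le hle ?_).symm
  rw [chartNet, finrank_span_eq_card hli, finrank_span_eq_card (linearIndependent_quads σ v)]

end Cover

/-! ### Powers of the ideal of a line, and lines in the charts -/

section Lines

variable {K : Type*} [Field K]

theorem span_pair_pow (a c : Poly K) (n : ℕ) : Submodule.span K {a, c} ^ n =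
    Submodule.span K (Set.range fun i : Fin (n + 1) => a ^ (i : ℕ) * c ^ (n - i : ℕ)) := by
  apply le_antisymm
  · induction n with
    | zero =>
      rw [pow_zero, Submodule.one_eq_span, Submodule.span_singleton_le_iff_mem]
      exact Submodule.subset_span ⟨0, by simp⟩
    | succ n ih =>
      rw [pow_succ]
      refine (mul_le_mul' ih le_rfl).trans ?_
      rw [Submodule.span_mul_span, Submodule.span_le]
      rintro _ ⟨_, ⟨i, rfl⟩, _, rfl | rfl, rfl⟩
      · refine Submodule.subset_span ⟨i.succ, ?_⟩
        simp only [Fin.val_succ, Nat.add_sub_add_right]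
        ring
      · refine Submodule.subset_span ⟨i.castSucc, ?_⟩
        have : n + 1 - (i : ℕ) = n - i + 1 := by omega
        simp only [Fin.val_castSucc, this]
        ring
  · rw [Submodule.span_le]
    rintro _ ⟨i, rfl⟩
    have h : (i : ℕ) + (n - i) = n := by omega
    have h1 := Submodule.mul_mem_mul
      (Submodule.pow_mem_pow (Submodule.span K {a, c}) (Submodule.subset_span (by simp : a ∈ _)) i)
      (Submodule.pow_mem_pow (Submodule.span K {a, c}) (Submodule.subset_span (by simp : c ∈ _))
        (n - i))
    rwa [← pow_add, h] at h1

theorem ideal_span_pow (Λ : Submodule K (Poly K)) (i : ℕ) :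
    Ideal.span (Λ : Set (Poly K)) ^ i =
      Ideal.span ((Λ ^ i : Submodule K (Poly K)) : Set (Poly K)) := by
  induction i with
  | zero =>
    rw [pow_zero, pow_zero, Ideal.one_eq_top, eq_comm, Ideal.eq_top_iff_one]
    exact Ideal.subset_span (Submodule.one_le.1 le_rfl)
  | succ n ih =>
    rw [pow_succ, ih, Ideal.span_mul_span', pow_succ, Submodule.mul_eq_span_mul_set]
    exact (Submodule.span_span_of_tower K (Poly K) _).symm

/-- Only the constant term of `a` contributes in degree `i`. -/
theorem homogeneousComponent_mul_mem {S : Submodule K (Poly K)} {i : ℕ} (hS : S ≤ Forms K i)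
    (a : Poly K) {s : Poly K} (hs : s ∈ S) : homogeneousComponent i (a * s) ∈ S := by
  induction a using MvPolynomial.induction_on' with
  | monomial m r =>
    have h := IsHomogeneous.mul (isHomogeneous_monomial r (rfl : m.degree = m.degree)) (hS hs)
    rw [homogeneousComponent_of_mem h]
    split_ifs with h0
    · have hm : m = 0 := by
        rw [← Finsupp.degree_eq_zero_iff]
        omega
      rw [hm, ← C_apply, ← smul_eq_C_mul]
      exact Submodule.smul_mem _ _ hs
    · exact zero_mem _
  | add p q hp hq =>
    rw [add_mul, map_add]
    exact add_mem hp hq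

theorem homogeneousComponent_mem_of_mem_span {S : Submodule K (Poly K)} {i : ℕ}
    (hS : S ≤ Forms K i) {x : Poly K} (hx : x ∈ Ideal.span (S : Set (Poly K))) :
    homogeneousComponent i x ∈ S := by
  have h : x ∈ (⊤ : Submodule K (Poly K)) * S := by
    induction hx using Submodule.span_induction with
    | zero => exact zero_mem _
    | add x y _ _ hx hy => exact add_mem hx hy
    | smul a x _ hx =>
      have h1 : a • x ∈ (⊤ : Submodule K (Poly K)) * (⊤ * S) :=
        Submodule.mul_mem_mul Submodule.mem_top hx
      rw [← mul_assoc] at h1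
      exact mul_le_mul' (le_top : (⊤ : Submodule K (Poly K)) * ⊤ ≤ ⊤) le_rfl h1
    | mem y hy =>
      rw [← one_mul y]
      exact Submodule.mul_mem_mul Submodule.mem_top hy
  refine Submodule.mul_induction_on h (fun a _ s hs => homogeneousComponent_mul_mem hS a hs)
    fun x y hx hy => ?_
  rw [map_add]
  exact add_mem hx hy

theorem pow_le_forms {Λ : Submodule K (Poly K)} (hΛ : Λ ≤ Forms K 1) (i : ℕ) :
    Λ ^ i ≤ Forms K i := by
  induction i with
  | zero =>
    rw [pow_zero, Submodule.one_le]
    exact isHomogeneous_one _ _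
  | succ n ih =>
    rw [pow_succ, Submodule.mul_le]
    exact fun x hx y hy => IsHomogeneous.mul (ih hx) (hΛ hy)

theorem formsOn_self {Λ : Submodule K (Poly K)} (hΛ : Λ ≤ Forms K 1) (i : ℕ) :
    formsOn Λ i i = Λ ^ i := by
  rw [formsOn, ideal_span_pow]
  apply le_antisymm
  · rintro x ⟨hx, hx'⟩
    have := homogeneousComponent_mem_of_mem_span (pow_le_forms hΛ i) hx'
    rwa [homogeneousComponent_eq_self hx] at this
  · exact fun x hx => ⟨pow_le_forms hΛ i hx, Ideal.subset_span hx⟩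

theorem cubicTimesLinear_eq {Λ : Submodule K (Poly K)} (hΛ : Λ ≤ Forms K 1) :
    cubicTimesLinear Λ = Λ ^ 3 * Forms K 1 := by
  rw [cubicTimesLinear, formsOn_self hΛ]

/-- The line with parameters `u`, as a space of linear forms. -/
noncomputable def chartLine (σ : Equiv.Perm (Fin 4)) (v : Par → K) : Submodule K (Poly K) :=
  Submodule.span K {lineForm σ v, lineForm' σ v}

theorem linearIndependent_line (σ : Equiv.Perm (Fin 4)) (v : Par → K) :
    LinearIndependent K ![lineForm σ v, lineForm' σ v] := by
  rw [LinearIndependent.pair_iff]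
  intro s t h
  have e : ∀ x : Fin 4 → K, eval x (s • lineForm σ v + t • lineForm' σ v) = 0 := fun x => by
    rw [h, map_zero]
  have e0 := e (fun i => if i = σ 0 then 1 else 0)
  have e1 := e (fun i => if i = σ 1 then 1 else 0)
  simp [lineForm, lineForm', eval_linForm, smul_eval] at e0 e1
  exact ⟨e0, e1⟩

theorem isLine_chartLine (σ : Equiv.Perm (Fin 4)) (v : Par → K) : IsLine (chartLine σ v) := by
  constructor
  · rw [chartLine, Submodule.span_le]
    rintro _ (rfl | rfl) <;> exact linForm_mem _ _
  · have := finrank_span_eq_card (linearIndependent_line σ v)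
    rwa [range_vec_two] at this

theorem normalForm_zero (σ : Equiv.Perm (Fin 4)) (u : Fin 2 × Fin 2 → K) (k : Fin 4) :
    normalForm σ (Sum.elim u 0) k = 0 := by
  simp [normalForm, linForm_apply]

theorem chartNet_zero (σ : Equiv.Perm (Fin 4)) (u : Fin 2 × Fin 2 → K) :
    chartNet σ (Sum.elim u 0) = chartLine σ (Sum.elim u 0) ^ 2 := by
  rw [chartLine, Set.pair_comm, span_pair_sq, chartNet, ← range_vec_three]
  congr 2
  ext1 i
  fin_cases i <;> simp [quads, normalForm_zero] <;> ring

theorem IsLine.exists_basis {Λ : Submodule K (Poly K)} (hΛ : IsLine Λ) :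
    ∃ l l', Λ = Submodule.span K {l, l'} ∧ LinearIndependent K ![l, l'] ∧
      l ∈ Forms K 1 ∧ l' ∈ Forms K 1 := by
  have : Module.Finite K Λ := Submodule.finiteDimensional_of_le hΛ.1
  let b := Module.finBasisOfFinrankEq K Λ hΛ.2
  have hli : LinearIndependent K (Λ.subtype ∘ b) :=
    b.linearIndependent.map' _ (Submodule.ker_subtype _)
  have hb : Λ.subtype ∘ b = ![(b 0 : Poly K), (b 1 : Poly K)] := by
    ext1 i
    fin_cases i <;> rfl
  refine ⟨b 0, b 1, ?_, hb ▸ hli, hΛ.1 (b 0).2, hΛ.1 (b 1).2⟩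
  rw [← range_vec_two, ← hb, Set.range_comp, Submodule.span_image, b.span_eq, Submodule.map_top,
    Submodule.range_subtype]

/-- Row reduction: the inverse of the leading `2 × 2` block brings the pair to the form `(1, 0, *,
*)`, `(0, 1, *, *)`. -/
theorem exists_chartLine_of_ne_zero (σ : Equiv.Perm (Fin 4)) {a b : Fin 4 → K}
    (h : a 0 * b 1 - a 1 * b 0 ≠ 0) (hΛ : IsLine (Submodule.span K {linForm σ a, linForm σ b})) :
    ∃ u, Submodule.span K {linForm σ a, linForm σ b} = chartLine σ (Sum.elim u 0) := by
  set δ := a 0 * b 1 - a 1 * b 0 with hδ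
  have hδ' : δ⁻¹ * δ = 1 := inv_mul_cancel₀ h
  let x : Fin 4 → K := fun i => δ⁻¹ * (b 1 * a i - a 1 * b i)
  let y : Fin 4 → K := fun i => δ⁻¹ * (a 0 * b i - b 0 * a i)
  let u : Fin 2 × Fin 2 → K := fun k => ![x (Fin.natAdd 2 k.2), y (Fin.natAdd 2 k.2)] k.1
  have hx0 : x 0 = 1 := by simp only [x]; rw [← hδ', hδ]; ring
  have hx1 : x 1 = 0 := by simp only [x]; ring
  have hy0 : y 0 = 0 := by simp only [y]; ring
  have hy1 : y 1 = 1 := by simp only [y]; rw [← hδ', hδ]; ring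
  have hH : lineForm σ (Sum.elim u 0) = (δ⁻¹ * b 1) • linForm σ a - (δ⁻¹ * a 1) • linForm σ b := by
    have : lineForm σ (Sum.elim u 0) = linForm σ x := by
      simp [lineForm, linForm_apply, u, hx0, hx1]
    rw [this]
    simp only [linForm_apply, x, smul_eq_C_mul, map_mul, map_sub]
    ring
  have hH' : lineForm' σ (Sum.elim u 0) =
      (δ⁻¹ * a 0) • linForm σ b - (δ⁻¹ * b 0) • linForm σ a := by
    have : lineForm' σ (Sum.elim u 0) = linForm σ y := by
      simp [lineForm', linForm_apply, u, hy0, hy1]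
    rw [this]
    simp only [linForm_apply, y, smul_eq_C_mul, map_mul, map_sub]
    ring
  refine ⟨u, (eq_of_le_of_finrank_ge_of_le_forms ?_ hΛ.1 ?_).symm⟩
  · have ma : linForm σ a ∈ Submodule.span K {linForm σ a, linForm σ b} :=
      Submodule.subset_span (by simp)
    have mb : linForm σ b ∈ Submodule.span K {linForm σ a, linForm σ b} :=
      Submodule.subset_span (by simp)
    rw [chartLine, Submodule.span_le]
    rintro _ (rfl | rfl)
    · rw [hH]
      exact sub_mem (Submodule.smul_mem _ _ ma) (Submodule.smul_mem _ _ mb)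
    · rw [hH']
      exact sub_mem (Submodule.smul_mem _ _ mb) (Submodule.smul_mem _ _ ma)
  · rw [hΛ.2, (isLine_chartLine σ _).2]

theorem exists_perm_fin_four (i j : Fin 4) (h : i ≠ j) :
    ∃ σ : Equiv.Perm (Fin 4), σ 0 = i ∧ σ 1 = j := by
  revert i j
  decide

theorem exists_chartLine {Λ : Submodule K (Poly K)} (hΛ : IsLine Λ) :
    ∃ σ u, Λ = chartLine σ (Sum.elim u 0) := by
  obtain ⟨l, l', rfl, hli, hl, hl'⟩ := hΛ.exists_basis
  obtain ⟨a, rfl⟩ := exists_linForm 1 hl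
  obtain ⟨b, rfl⟩ := exists_linForm 1 hl'
  obtain ⟨i, j, hij⟩ : ∃ i j, a i * b j - a j * b i ≠ 0 := by
    by_contra hne
    push Not at hne
    rw [LinearIndependent.pair_iff] at hli
    have h1 : ∀ i, b i = 0 ∧ -a i = 0 := by
      intro i
      apply hli
      simp only [linForm_apply, smul_eq_C_mul]
      have e : ∀ k, (C (b i) * C (a k) - C (a i) * C (b k) : Poly K) = 0 := fun k => by
        rw [← map_mul, ← map_mul, ← map_sub, mul_comm (b i), hne k i, map_zero]
      simp only [map_neg]
      linear_combination X ((1 : Equiv.Perm (Fin 4)) 0) * e 0 +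
        X ((1 : Equiv.Perm (Fin 4)) 1) * e 1 + X ((1 : Equiv.Perm (Fin 4)) 2) * e 2 +
        X ((1 : Equiv.Perm (Fin 4)) 3) * e 3
    have h2 := hli 0 1 (by
      simp [linForm_apply, (h1 _).1])
    exact one_ne_zero h2.2
  have hne : i ≠ j := by
    rintro rfl
    exact hij (sub_self _)
  obtain ⟨σ, rfl, rfl⟩ := exists_perm_fin_four i j hne
  have hσ : ∀ c : Fin 4 → K, linForm 1 c = linForm σ (c ∘ σ) := by
    intro c
    simp only [linForm]
    rw [← Equiv.sum_comp σ]
    rfl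
  rw [hσ a, hσ b] at hΛ ⊢
  obtain ⟨u, hu⟩ := exists_chartLine_of_ne_zero σ (a := a ∘ σ) (b := b ∘ σ) hij hΛ
  exact ⟨σ, u, hu⟩

/-- The base Plücker coordinate of the squared line is, up to a nonzero factor, the cube of the
leading `2 × 2` minor of the line. -/
theorem exists_chartLine_of_isPlucker (σ : Equiv.Perm (Fin 4)) {Λ : Submodule K (Poly K)}
    (hΛ : IsLine Λ) {p : PIdx → K} (hp : IsPlucker (Λ ^ 2) p) (h0 : p (baseIdx σ) ≠ 0) :
    ∃ u, Λ = chartLine σ (Sum.elim u 0) := by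
  obtain ⟨l, l', rfl, hli, hl, hl'⟩ := hΛ.exists_basis
  obtain ⟨a, rfl⟩ := exists_linForm σ hl
  obtain ⟨b, rfl⟩ := exists_linForm σ hl'
  refine exists_chartLine_of_ne_zero σ (fun hδ => h0 ?_) hΛ
  have hspan := span_pair_sq (linForm σ a) (linForm σ b)
  rw [← range_vec_three] at hspan
  have hli3 : LinearIndependent K
      ![linForm σ a ^ 2, linForm σ a * linForm σ b, linForm σ b ^ 2] := by
    obtain ⟨q, hq, hq', -⟩ := hp
    rw [linearIndependent_iff_card_eq_finrank_span, Set.finrank, ← hspan, ← hq',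
      finrank_span_eq_card hq]
  obtain ⟨t, ht, htp⟩ := IsPlucker.exists_smul ⟨_, hli3, hspan.symm, rfl⟩ hp
  rw [htp]
  simp [plucker, Matrix.det_fin_three, baseIdx, sq, coeff_linForm_mul]
  right
  linear_combination -(a 0 * b 1 - a 1 * b 0) ^ 2 * hδ

end Lines

/-! ### The limit quartic of a normal direction -/

section NormalQuartic

variable {R : Type*} [CommRing R]

/-- The cubic forms `R₀, …, R₃` with `q₀ q₂ - q₁² = ∑ Pₖ Rₖ`. -/
noncomputable def cubic (σ : Equiv.Perm (Fin 4)) (v : Par → R) : Fin 4 → MvPolynomial (Fin 4) R :=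
  let H := lineForm σ v
  let H' := lineForm' σ v
  let P := normalForm σ v
  ![H' ^ 3 + P 3 * H' ^ 2, H * H' ^ 2 + P 3 * H * H',
    -H ^ 3 - 2 * P 1 * H ^ 2 - 3 * P 0 * H * H' - P 1 ^ 2 * H - P 1 * P 0 * H' - P 2 * P 0 ^ 2 -
      2 * P 3 * P 0 * H, -H ^ 2 * H' - P 3 * H ^ 2]

/-- The conic relation valid on squares of lines fails, nearby, by an explicit combination of the
normal parameters; this is what can be divided by `t` in the limit. -/
theorem quads_relation (σ : Equiv.Perm (Fin 4)) (v : Par → R) :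
    quads σ v 0 * quads σ v 2 - quads σ v 1 ^ 2 = ∑ k, normalForm σ v k * cubic σ v k := by
  simp only [Fin.sum_univ_four, quads, cubic, Matrix.cons_val]
  ring

theorem map_cubic {S : Type*} [CommRing S] (φ : R →+* S) (σ : Equiv.Perm (Fin 4)) (v : Par → R)
    (k : Fin 4) : MvPolynomial.map φ (cubic σ v k) = cubic σ (fun i => φ (v i)) k := by
  fin_cases k <;> simp [cubic, map_lineForm, map_lineForm', map_normalForm]

variable {K : Type*} [Field K]

/-- The limit quartic form attached to a normal direction `w` at the line with parameters `u`. -/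
noncomputable def normalQuartic (σ : Equiv.Perm (Fin 4)) (u : Fin 2 × Fin 2 → K) :
    (Fin 4 × Fin 2 → K) →ₗ[K] Poly K where
  toFun w := ∑ k, normalForm σ (Sum.elim u w) k * cubic σ (Sum.elim u 0) k
  map_add' w w' := by
    rw [← Finset.sum_add_distrib]
    refine Finset.sum_congr rfl fun k _ => ?_
    simp [normalForm, linForm_apply]
    ring
  map_smul' c w := by
    rw [Finset.smul_sum]
    refine Finset.sum_congr rfl fun k _ => ?_
    simp [normalForm, linForm_apply, smul_eq_C_mul]
    ring

theorem normalQuartic_apply (σ : Equiv.Perm (Fin 4)) (u : Fin 2 × Fin 2 → K)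
    (w : Fin 4 × Fin 2 → K) : normalQuartic σ u w =
      ∑ k, normalForm σ (Sum.elim u w) k * cubic σ (Sum.elim u 0) k := rfl

theorem cubic_zero (σ : Equiv.Perm (Fin 4)) (u : Fin 2 × Fin 2 → K) :
    cubic σ (Sum.elim u 0) = ![lineForm' σ (Sum.elim u 0) ^ 3,
      lineForm σ (Sum.elim u 0) * lineForm' σ (Sum.elim u 0) ^ 2,
      -lineForm σ (Sum.elim u 0) ^ 3,
      -lineForm σ (Sum.elim u 0) ^ 2 * lineForm' σ (Sum.elim u 0)] := by
  ext1 k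
  fin_cases k <;> simp [cubic, normalForm_zero]

theorem cubic_mem (σ : Equiv.Perm (Fin 4)) (u : Fin 2 × Fin 2 → K) (k : Fin 4) :
    cubic σ (Sum.elim u 0) k ∈ chartLine σ (Sum.elim u 0) ^ 3 := by
  have h : ∀ i : Fin 4, lineForm σ (Sum.elim u 0) ^ (i : ℕ) *
      lineForm' σ (Sum.elim u 0) ^ (3 - i : ℕ) ∈ chartLine σ (Sum.elim u 0) ^ 3 := fun i => by
    rw [chartLine, span_pair_pow]
    exact Submodule.subset_span ⟨i, rfl⟩
  rw [cubic_zero]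
  fin_cases k
  · simpa using h 0
  · simpa using h 1
  · simpa using h 3
  · simpa using h 2

theorem normalQuartic_mem (σ : Equiv.Perm (Fin 4)) (u : Fin 2 × Fin 2 → K)
    (w : Fin 4 × Fin 2 → K) :
    normalQuartic σ u w ∈ cubicTimesLinear (chartLine σ (Sum.elim u 0)) := by
  rw [cubicTimesLinear_eq (isLine_chartLine _ _).1, normalQuartic_apply]
  refine sum_mem fun k _ => ?_
  rw [mul_comm (normalForm _ _ _)]
  exact Submodule.mul_mem_mul (cubic_mem σ u k) (linForm_mem _ _)

theorem forms_one_le (σ : Equiv.Perm (Fin 4)) (v : Par → K) :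
    Forms K 1 ≤ chartLine σ v ⊔ Submodule.span K {X (σ 2), X (σ 3)} := by
  intro l hl
  obtain ⟨a, rfl⟩ := exists_linForm σ hl
  have h : linForm σ a = (a 0 • lineForm σ v + a 1 • lineForm' σ v) +
      ((a 2 - a 0 * v (Sum.inl (0, 0)) - a 1 * v (Sum.inl (1, 0))) • X (σ 2) +
      (a 3 - a 0 * v (Sum.inl (0, 1)) - a 1 * v (Sum.inl (1, 1))) • X (σ 3)) := by
    simp [linForm_apply, lineForm, lineForm', smul_eq_C_mul]
    ring
  rw [h]
  refine Submodule.add_mem_sup (add_mem ?_ ?_) (add_mem ?_ ?_) <;>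
    refine Submodule.smul_mem _ _ (Submodule.subset_span (by simp))

/-- Modulo the line, linear forms are spanned by `X (σ 2)` and `X (σ 3)`. Their eight products with
the cubics are the images of the coordinate directions. -/
theorem cubicTimesLinear_le (σ : Equiv.Perm (Fin 4)) (u : Fin 2 × Fin 2 → K) :
    cubicTimesLinear (chartLine σ (Sum.elim u 0)) ≤
      chartLine σ (Sum.elim u 0) ^ 4 ⊔ LinearMap.range (normalQuartic σ u) := by
  rw [cubicTimesLinear_eq (isLine_chartLine _ _).1]
  refine (mul_le_mul' le_rfl (forms_one_le σ (Sum.elim u 0))).trans ?_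
  rw [Submodule.mul_sup, ← pow_succ]
  refine sup_le_sup le_rfl ?_
  have h3 : chartLine σ (Sum.elim u 0) ^ 3 ≤
      Submodule.span K (Set.range (cubic σ (Sum.elim u 0))) := by
    rw [chartLine, span_pair_pow, Submodule.span_le]
    have h : ∀ k, cubic σ (Sum.elim u 0) k ∈
        Submodule.span K (Set.range (cubic σ (Sum.elim u 0))) := fun k =>
      Submodule.subset_span ⟨k, rfl⟩
    rw [cubic_zero] at h ⊢
    rintro _ ⟨i, rfl⟩
    fin_cases i
    · simpa using h 0
    · simpa using h 1
    · simpa using h 3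
    · simpa using h 2
  refine (mul_le_mul' h3 le_rfl).trans ?_
  rw [Submodule.span_mul_span, Submodule.span_le]
  have hs : ∀ (k : Fin 4) (l : Fin 2), X (σ (Fin.natAdd 2 l)) * cubic σ (Sum.elim u 0) k =
      normalQuartic σ u (Pi.single (k, l) 1) := by
    intro k l
    rw [normalQuartic_apply, Finset.sum_eq_single k]
    · congr 1
      fin_cases l <;> simp [normalForm, linForm_apply]
    · intro k' _ hk'
      have : normalForm σ (Sum.elim u (Pi.single (k, l) 1)) k' = 0 := by
        simp [normalForm, linForm_apply, hk']
      rw [this, zero_mul]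
    · simp
  rintro _ ⟨_, ⟨k, rfl⟩, _, rfl | rfl, rfl⟩
  · exact ⟨_, (hs k 0).symm.trans (mul_comm _ _)⟩
  · exact ⟨_, (hs k 1).symm.trans (mul_comm _ _)⟩

theorem eq_zero_of_sum_pow_eq_zero [Infinite K] {n : ℕ} {c : Fin n → K}
    (h : ∀ t : K, ∑ i, c i * t ^ (i : ℕ) = 0) (i : Fin n) : c i = 0 := by
  let P : Polynomial K := ∑ i, Polynomial.C (c i) * Polynomial.X ^ (i : ℕ)
  have hP : P = 0 := Polynomial.funext fun t => by
    simpa [P, Polynomial.eval_finsetSum] using h t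
  have := congrArg (Polynomial.coeff · i) hP
  simpa [P, Polynomial.finsetSum_coeff, Polynomial.coeff_X_pow, Fin.val_inj] using this

/-- On the points with `H = t`, `H' = 1` and free remaining coordinates `y, z`, the relation is a
polynomial in `t`: `y = z = 0` isolates `c`, then `(1, 0)` and `(0, 1)` isolate `w`. -/
theorem normalQuartic_independent [Infinite K] (σ : Equiv.Perm (Fin 4)) (u : Fin 2 × Fin 2 → K)
    (c : Fin 5 → K) (w : Fin 4 × Fin 2 → K)
    (h : ∑ i, c i • (lineForm σ (Sum.elim u 0) ^ (i : ℕ) *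
      lineForm' σ (Sum.elim u 0) ^ (4 - i : ℕ)) + normalQuartic σ u w = 0) : c = 0 ∧ w = 0 := by
  have key : ∀ t y z : K, ∑ i, c i * t ^ (i : ℕ) +
      ((w (0, 0) * y + w (0, 1) * z) + (w (1, 0) * y + w (1, 1) * z) * t -
        (w (3, 0) * y + w (3, 1) * z) * t ^ 2 - (w (2, 0) * y + w (2, 1) * z) * t ^ 3) = 0 := by
    intro t y z
    let x : Fin 4 → K := ![t - u (0, 0) * y - u (0, 1) * z, 1 - u (1, 0) * y - u (1, 1) * z,
      y, z] ∘ σ.symm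
    have hH : eval x (lineForm σ (Sum.elim u 0)) = t := by
      simp [lineForm, eval_linForm, Fin.sum_univ_four, x]; ring
    have hH' : eval x (lineForm' σ (Sum.elim u 0)) = 1 := by
      simp [lineForm', eval_linForm, Fin.sum_univ_four, x]; ring
    have hP : ∀ k, eval x (normalForm σ (Sum.elim u w) k) = w (k, 0) * y + w (k, 1) * z := by
      intro k
      simp [normalForm, eval_linForm, Fin.sum_univ_four, x]
    have := congrArg (eval x) h
    rw [normalQuartic_apply, cubic_zero, map_add, map_sum, map_sum, map_zero] at this
    simp only [smul_eval, map_mul, map_pow, hH, hH', hP, one_pow, mul_one] at this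
    rw [← this, Fin.sum_univ_four]
    simp [hH, hH']
    ring
  have hc : ∀ i, c i = 0 := eq_zero_of_sum_pow_eq_zero fun t => by simpa using key t 0 0
  have hw : ∀ y z : K, ∀ i : Fin 4, ![w (0, 0) * y + w (0, 1) * z, w (1, 0) * y + w (1, 1) * z,
      -(w (3, 0) * y + w (3, 1) * z), -(w (2, 0) * y + w (2, 1) * z)] i = 0 := fun y z =>
    eq_zero_of_sum_pow_eq_zero fun t => by
      have := key t y z
      simp only [hc, zero_mul, Finset.sum_const_zero, zero_add] at this
      rw [← this, Fin.sum_univ_four]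
      simp
      ring
  refine ⟨funext hc, funext fun ⟨k, l⟩ => ?_⟩
  have h0 := hw 1 0
  have h1 := hw 0 1
  have a0 := h0 0
  have a1 := h0 1
  have a2 := h0 2
  have a3 := h0 3
  have b0 := h1 0
  have b1 := h1 1
  have b2 := h1 2
  have b3 := h1 3
  simp at a0 a1 a2 a3 b0 b1 b2 b3
  fin_cases k <;> fin_cases l <;> assumption

theorem eq_zero_of_normalQuartic_mem [Infinite K] (σ : Equiv.Perm (Fin 4))
    (u : Fin 2 × Fin 2 → K) {w : Fin 4 × Fin 2 → K}
    (h : normalQuartic σ u w ∈ chartLine σ (Sum.elim u 0) ^ 4) : w = 0 := by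
  rw [chartLine, span_pair_pow, Submodule.mem_span_range_iff_exists_fun] at h
  obtain ⟨c, hc⟩ := h
  refine (normalQuartic_independent σ u (-c) w ?_).2
  rw [← hc, ← Finset.sum_add_distrib]
  simp

theorem finrank_chartLine_pow_four_sup [Infinite K] (σ : Equiv.Perm (Fin 4))
    (u : Fin 2 × Fin 2 → K) {w : Fin 4 × Fin 2 → K} (hw : w ≠ 0) :
    finrank K ↥(chartLine σ (Sum.elim u 0) ^ 4 ⊔ Submodule.span K {normalQuartic σ u w}) = 6 := by
  let q : Fin 6 → Poly K := Fin.cons (normalQuartic σ u w) fun i : Fin 5 =>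
    lineForm σ (Sum.elim u 0) ^ (i : ℕ) * lineForm' σ (Sum.elim u 0) ^ (4 - i : ℕ)
  have hq : LinearIndependent K q := by
    rw [Fintype.linearIndependent_iff]
    intro g hg
    rw [Fin.sum_univ_succ, add_comm] at hg
    simp only [q, Fin.cons_zero, Fin.cons_succ] at hg
    rw [← map_smul] at hg
    obtain ⟨h1, h2⟩ := normalQuartic_independent σ u _ _ hg
    have h3 : g 0 = 0 := (smul_eq_zero.1 h2).resolve_right hw
    exact Fin.cases h3 (fun i => congrFun h1 i)
  have hspan : Submodule.span K (Set.range q) =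
      chartLine σ (Sum.elim u 0) ^ 4 ⊔ Submodule.span K {normalQuartic σ u w} := by
    rw [Fin.range_cons, Submodule.span_insert, sup_comm, chartLine, span_pair_pow]
  rw [← hspan, finrank_span_eq_card hq, Fintype.card_fin]

end NormalQuartic

/-! ### The blow-up in a chart -/

section LocalStructure

variable {K : Type*} [Field K]

theorem eval_smul_of_isHomogeneous {ι : Type*} {F : MvPolynomial ι K} {d : ℕ}
    (hF : F.IsHomogeneous d) (a : K) (p : ι → K) : eval (a • p) F = a ^ d * eval p F := by
  rw [eval_eq, eval_eq, Finset.mul_sum]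
  refine Finset.sum_congr rfl fun e he => ?_
  have hd : ∑ x ∈ e.support, e x = d := by
    have := hF (mem_support_iff.1 he)
    rw [← this]; simp [Finsupp.weight_apply, Finsupp.sum]
  simp only [Pi.smul_apply, smul_eq_mul, mul_pow, Finset.prod_mul_distrib,
    Finset.prod_pow_eq_pow_sum, hd]
  ring

/-- Restriction of polynomials in the Plücker coordinates to a chart. -/
noncomputable def pullback (σ : Equiv.Perm (Fin 4)) :
    MvPolynomial PIdx K →ₐ[K] MvPolynomial Par K :=
  aeval (chartPlucker σ (X : Par → MvPolynomial Par K))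

theorem eval_pullback (σ : Equiv.Perm (Fin 4)) (v : Par → K) (F : MvPolynomial PIdx K) :
    eval v (pullback σ F) = eval (chartPlucker σ v) F := by
  have h : ∀ s, eval v (chartPlucker σ (X : Par → MvPolynomial Par K) s) = chartPlucker σ v s :=
    fun s => by rw [map_chartPlucker]; simp
  induction F using MvPolynomial.induction_on with
  | C a => simp [pullback]
  | add p q hp hq => simp only [map_add, hp, hq]
  | mul_X p i hp => rw [map_mul, map_mul, hp, map_mul, eval_X, pullback, aeval_X, h]

theorem chartNet_zero_mem_squareNets (σ : Equiv.Perm (Fin 4)) (u : Fin 2 × Fin 2 → K) :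
    chartNet σ (Sum.elim u 0) ∈ squareNets K :=
  ⟨_, isLine_chartLine σ _, chartNet_zero σ u⟩

/-- Setting the `β` variables to zero changes `F` only by an element of the ideal they generate, and
here the result is the zero polynomial. -/
theorem exists_coefficients_of_eval_eq_zero [Infinite K] {α β : Type*} [Fintype β]
    (F : MvPolynomial (α ⊕ β) K) (hF : ∀ u : α → K, eval (Sum.elim u 0) F = 0) :
    ∃ b : β → MvPolynomial (α ⊕ β) K, F = ∑ k, b k * X (Sum.inr k) := by
  let φ : MvPolynomial (α ⊕ β) K →ₐ[K] MvPolynomial α K := aeval (Sum.elim X 0)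
  have hφ : φ F = 0 := by
    refine MvPolynomial.funext fun u => ?_
    rw [map_zero, ← hF u]
    clear hF
    induction F using MvPolynomial.induction_on with
    | C a => simp [φ]
    | add p q hp hq => simp only [map_add, hp, hq]
    | mul_X p i hp =>
      rw [map_mul, map_mul, hp, map_mul, eval_X]
      rcases i with i | i <;> simp [φ]
  have h : ∀ F, F - rename Sum.inl (φ F) ∈
      Ideal.span (Set.range fun k : β => (X (Sum.inr k) : MvPolynomial (α ⊕ β) K)) := by
    intro F
    rw [← Ideal.Quotient.eq]
    let I := Ideal.span (Set.range fun k : β => (X (Sum.inr k) : MvPolynomial (α ⊕ β) K))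
    have h1 : Ideal.Quotient.mkₐ K I =
        (Ideal.Quotient.mkₐ K I).comp ((rename Sum.inl).comp φ) := by
      refine MvPolynomial.algHom_ext fun i => ?_
      rcases i with i | i
      · simp [φ]
      · simp only [AlgHom.comp_apply, φ, aeval_X, Sum.elim_inr, Pi.zero_apply, map_zero]
        exact Ideal.Quotient.eq_zero_iff_mem.2 (Ideal.subset_span ⟨i, rfl⟩)
    exact AlgHom.congr_fun h1 F
  have h1 := h F
  rw [hφ, map_zero, sub_zero, Ideal.mem_span_range_iff_exists_fun] at h1
  obtain ⟨b, hb⟩ := h1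
  exact ⟨b, hb.symm⟩

/-- The base coordinate handles the squares outside the chart; inside it the normal parameters of a
square vanish. -/
theorem base_mul_chartCoord_mem (σ : Equiv.Perm (Fin 4)) (k : Fin 4 × Fin 2) :
    X (baseIdx σ) * chartCoord K σ (Sum.inr k) ∈ netIdeal (squareNets K) := by
  rintro p ⟨π, ⟨Λ, hΛ, rfl⟩, hp⟩
  change eval p _ = 0
  rw [map_mul, eval_X]
  by_cases h0 : p (baseIdx σ) = 0
  · rw [h0, zero_mul]
  · obtain ⟨u, rfl⟩ := exists_chartLine_of_isPlucker σ hΛ hp h0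
    rw [← chartNet_zero] at hp
    rw [eq_smul_chartPlucker σ hp, eval_chartCoord]
    simp

theorem pullback_eq_zero [Infinite K] (σ : Equiv.Perm (Fin 4)) {F : MvPolynomial PIdx K}
    (hF : F ∈ netIdeal (detNets K)) : pullback σ F = 0 := by
  refine MvPolynomial.funext fun v => ?_
  rw [eval_pullback, map_zero]
  exact hF _ ⟨_, chartNet_mem_detNets σ v, isPlucker_chartNet σ v⟩

variable {m d : ℕ} {f : Fin m → MvPolynomial PIdx K}

/-- The base coordinate restricts to `1` on the chart, so neither saturation nor the extra factor of
`base_mul_chartCoord_mem` leaves a trace there. -/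
theorem IsBlowupSystem.exists_generates [Infinite K] (hf : IsBlowupSystem d f)
    (σ : Equiv.Perm (Fin 4)) (k : Fin 4 × Fin 2) :
    ∃ a : Fin m → MvPolynomial Par K, X (Sum.inr k) = ∑ i, a i * pullback σ (f i) := by
  obtain ⟨N, hN⟩ := hf.generates
  have h1 : X (baseIdx σ) ^ N ∈ idealOfVars PIdx K ^ N :=
    Ideal.pow_mem_pow (Ideal.subset_span (Set.mem_range_self _)) N
  obtain ⟨y, hy, z, hz, hyz⟩ := Submodule.mem_sup.1
    (hN (Ideal.mul_mem_mul (base_mul_chartCoord_mem σ k) h1))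
  obtain ⟨a, ha⟩ := Ideal.mem_span_range_iff_exists_fun.1 hy
  refine ⟨fun i => pullback σ (a i), ?_⟩
  have h2 := congrArg (pullback σ) hyz
  rw [map_add, pullback_eq_zero σ hz, add_zero, ← ha, map_sum] at h2
  simp only [map_mul] at h2
  rw [h2]
  refine MvPolynomial.funext fun v => ?_
  have h3 := eval_chartCoord σ 1 v (Sum.inr k)
  rw [one_smul, one_mul] at h3
  simp only [map_mul, map_pow, eval_pullback, eval_X, chartPlucker_baseIdx, h3]
  ring

/-- In a chart, the forms `f` and the eight normal parameters generate the same ideal: matrices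
`A`, `B` that express one system of generators by the other one. -/
structure IsNormalPresentation (f : Fin m → MvPolynomial PIdx K) (σ : Equiv.Perm (Fin 4))
    (A : Fin 4 × Fin 2 → Fin m → MvPolynomial Par K)
    (B : Fin m → Fin 4 × Fin 2 → MvPolynomial Par K) : Prop where
  forms_eq : ∀ v i, eval (chartPlucker σ v) (f i) = ∑ k, eval v (B i k) * v (Sum.inr k)
  param_eq : ∀ v k, v (Sum.inr k) = ∑ i, eval v (A k i) * eval (chartPlucker σ v) (f i)

theorem IsBlowupSystem.exists_normalPresentation [Infinite K] (hf : IsBlowupSystem d f)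
    (σ : Equiv.Perm (Fin 4)) : ∃ A B, IsNormalPresentation f σ A B := by
  choose A hA using hf.exists_generates σ
  have h : ∀ i, ∃ b : Fin 4 × Fin 2 → MvPolynomial Par K,
      pullback σ (f i) = ∑ k, b k * X (Sum.inr k) := fun i =>
    exists_coefficients_of_eval_eq_zero _ fun u => by
      rw [eval_pullback]
      exact hf.vanishes i _ ⟨_, chartNet_zero_mem_squareNets σ u, isPlucker_chartNet σ _⟩
  choose B hB using h
  refine ⟨A, B, fun v i => ?_, fun v k => ?_⟩
  · rw [← eval_pullback, hB, map_sum]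
    simp
  · have := congrArg (eval v) (hA k)
    rw [eval_X, map_sum] at this
    simp only [map_mul, eval_pullback] at this
    exact this

variable {σ : Equiv.Perm (Fin 4)} {A : Fin 4 × Fin 2 → Fin m → MvPolynomial Par K}
  {B : Fin m → Fin 4 × Fin 2 → MvPolynomial Par K}

/-- The derivative of the forms `f` along the normal directions at the point `u`. -/
noncomputable def normalMap (B : Fin m → Fin 4 × Fin 2 → MvPolynomial Par K)
    (u : Fin 2 × Fin 2 → K) : (Fin 4 × Fin 2 → K) →ₗ[K] (Fin m → K) where
  toFun w i := ∑ k, eval (Sum.elim u 0) (B i k) * w k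
  map_add' w w' := by
    ext i
    simp [mul_add, Finset.sum_add_distrib]
  map_smul' c w := by
    ext i
    simp only [Pi.smul_apply, smul_eq_mul, RingHom.id_apply, Finset.mul_sum]
    exact Finset.sum_congr rfl fun k _ => by ring

theorem normalMap_apply (B : Fin m → Fin 4 × Fin 2 → MvPolynomial Par K)
    (u : Fin 2 × Fin 2 → K) (w : Fin 4 × Fin 2 → K) (i : Fin m) :
    normalMap B u w i = ∑ k, eval (Sum.elim u 0) (B i k) * w k := rfl

/-- The curve through the point `u` in the direction `w`. -/
noncomputable def normalCurve (u : Fin 2 × Fin 2 → K) (w : Fin 4 × Fin 2 → K) :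
    Par → Polynomial K :=
  Sum.elim (fun k => Polynomial.C (u k)) (fun k => Polynomial.C (w k) * Polynomial.X)

theorem eval_normalCurve (u : Fin 2 × Fin 2 → K) (w : Fin 4 × Fin 2 → K) (t : K) :
    (fun k => (normalCurve u w k).eval t) = Sum.elim u (t • w) := by
  ext k
  rcases k with k | k
  · simp [normalCurve]
  · simp only [normalCurve, Sum.elim_inr, Polynomial.eval_mul, Polynomial.eval_C,
      Polynomial.eval_X, Pi.smul_apply, smul_eq_mul]
    ring

/-- Substituting one presentation into the other gives `t w = A B (t w)` along the normal curve;
cancel `t` and then set `t = 0`. -/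
theorem IsNormalPresentation.left_inverse [Infinite K] (h : IsNormalPresentation f σ A B)
    (u : Fin 2 × Fin 2 → K) (w : Fin 4 × Fin 2 → K) (k : Fin 4 × Fin 2) :
    ∑ i, eval (Sum.elim u 0) (A k i) * normalMap B u w i = w k := by
  let g : MvPolynomial Par K := ∑ i, A k i * ∑ l, B i l * C (w l) - C (w k)
  have h0 := eval_eq_zero_of_curve g (normalCurve u w) Polynomial.X_ne_zero (fun t ht => by
    rw [Polynomial.eval_X] at ht
    rw [eval_normalCurve]
    refine (mul_eq_zero.1 (?_ : t * _ = 0)).resolve_left ht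
    have h1 := h.param_eq (Sum.elim u (t • w)) k
    simp only [h.forms_eq, Sum.elim_inr, Pi.smul_apply, smul_eq_mul] at h1
    simp only [g, map_sub, map_sum, map_mul, eval_C, mul_sub]
    rw [h1, sub_eq_zero, Finset.mul_sum]
    refine Finset.sum_congr rfl fun i _ => ?_
    rw [mul_left_comm, Finset.mul_sum]
    congr 1
    exact Finset.sum_congr rfl fun l _ => by ring) 0
  rw [eval_normalCurve, zero_smul] at h0
  simp only [g, map_sub, map_sum, map_mul, eval_C, sub_eq_zero] at h0
  exact h0

theorem IsNormalPresentation.injective [Infinite K] (h : IsNormalPresentation f σ A B)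
    (u : Fin 2 × Fin 2 → K) : Function.Injective (normalMap B u) := by
  intro w w' hw
  ext k
  rw [← h.left_inverse u w k, hw, h.left_inverse]

theorem baseIdx_ne_zero (σ : Equiv.Perm (Fin 4)) {v : Par → K} {p : PIdx → K}
    (hp : IsPlucker (chartNet σ v) p) : p (baseIdx σ) ≠ 0 := by
  obtain ⟨s, hs⟩ := hp.exists_ne_zero (detNets_le_forms (chartNet_mem_detNets σ _))
  intro h0
  have := congrFun (eq_smul_chartPlucker σ hp) s
  rw [Pi.smul_apply, h0, zero_smul] at this
  exact hs this

theorem exists_chart_of_graph (hf : IsBlowupSystem d f) (σ : Equiv.Perm (Fin 4)) {z : Pt K m}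
    (hz : z ∈ graph f) {c : PIdx ⊕ Fin m → K} (hc : IsCoord z c)
    (h0 : c (Sum.inl (baseIdx σ)) ≠ 0) : ∃ v b, z.1 = chartNet σ v ∧
      (fun s => c (Sum.inl s)) = c (Sum.inl (baseIdx σ)) • chartPlucker σ v ∧
      ∀ i, c (Sum.inr i) = b * eval (chartPlucker σ v) (f i) := by
  obtain ⟨hd, -, p, hp, hne, hz2⟩ := hz
  obtain ⟨v, hv, hcv⟩ := exists_chart σ hd hc.1 h0
  obtain ⟨hne', hz2'⟩ := hc.2
  obtain ⟨t, ht⟩ := (Projectivization.mk_eq_mk_iff' K _ _ hne' hne).1 (hz2' ▸ hz2)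
  rw [hv] at hp
  refine ⟨v, t * p (baseIdx σ) ^ d, hv, hcv, fun i => ?_⟩
  have := congrFun ht i
  rw [← this, eq_smul_chartPlucker σ hp]
  simp only [Pi.smul_apply, smul_eq_mul, eval_smul_of_isHomogeneous (hf.homogeneous i),
    chartPlucker_baseIdx]
  ring

theorem exists_common_bound {ι : Type*} [Fintype ι] {P : ι → ℕ → Prop}
    (h : ∀ i, ∃ D₀, ∀ D ≥ D₀, P i D) : ∃ D, ∀ i, P i D := by
  choose D hD using h
  exact ⟨Finset.univ.sup D, fun i => hD i _ (Finset.le_sup (Finset.mem_univ i))⟩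

theorem eval_rename_inl (c : PIdx ⊕ Fin m → K) (G : MvPolynomial PIdx K) :
    eval c (rename Sum.inl G) = eval (fun s => c (Sum.inl s)) G := by
  rw [eval_rename]
  rfl

/-- On the graph the last coordinates `y` are proportional to `f`, so `y = B (A y)` because `A`
takes `f` to `w` and `B` takes `w` to `f`. Homogenised, this equation persists on the closure. -/
theorem IsNormalPresentation.mem_range (h : IsNormalPresentation f σ A B)
    (hf : IsBlowupSystem d f) {z : Pt K m} (hz : z ∈ blowup f) {u : Fin 2 × Fin 2 → K}
    (hu : z.1 = chartNet σ (Sum.elim u 0)) {c : PIdx ⊕ Fin m → K} (hc : IsCoord z c) :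
    (fun i => c (Sum.inr i)) =
      normalMap B u (fun k => ∑ j, eval (Sum.elim u 0) (A k j) * c (Sum.inr j)) := by
  ext i
  let g : Fin m → MvPolynomial Par K := fun j => (if i = j then 1 else 0) - ∑ k, B i k * A k j
  obtain ⟨D, hD⟩ := exists_common_bound fun j => exists_homogeneous_lift σ (g j)
  choose G hG using hD
  have hsum : ∀ (v : Par → K) (y : Fin m → K), ∑ j, eval v (g j) * y j =
      y i - ∑ k, eval v (B i k) * ∑ j, eval v (A k j) * y j := by
    intro v y
    simp only [g, map_sub, map_sum, map_mul, sub_mul, Finset.sum_sub_distrib]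
    congr 1
    · simp [apply_ite (eval v)]
    · simp only [Finset.sum_mul, Finset.mul_sum]
      rw [Finset.sum_comm]
      exact Finset.sum_congr rfl fun k _ => Finset.sum_congr rfl fun j _ => by ring
  have key := hz.2 (X (Sum.inl (baseIdx σ)) * ∑ j, rename Sum.inl (G j) * X (Sum.inr j))
    (fun w hw c hc => by
      rw [map_mul, eval_X]
      by_cases h0 : c (Sum.inl (baseIdx σ)) = 0
      · rw [h0, zero_mul]
      obtain ⟨v, b, -, hv, hb⟩ := exists_chart_of_graph hf σ hw hc h0
      rw [map_sum]
      simp only [map_mul, eval_rename_inl, hv, hG, eval_X, hb, mul_assoc]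
      rw [← Finset.mul_sum, hsum v fun i => b * eval (chartPlucker σ v) (f i)]
      have h1 : ∀ k, ∑ j, eval v (A k j) * (b * eval (chartPlucker σ v) (f j)) =
          b * v (Sum.inr k) := fun k => by
        rw [h.param_eq v k, Finset.mul_sum]
        exact Finset.sum_congr rfl fun j _ => by ring
      have h2 : ∑ k, eval v (B i k) * (b * v (Sum.inr k)) =
          b * eval (chartPlucker σ v) (f i) := by
        rw [h.forms_eq v i, Finset.mul_sum]
        exact Finset.sum_congr rfl fun j _ => by ring
      simp only [h1, h2, sub_self, mul_zero]) c hc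
  have hp := hc.1
  rw [hu] at hp
  have hcu := eq_smul_chartPlucker σ hp
  have h0 : c (Sum.inl (baseIdx σ)) ≠ 0 := baseIdx_ne_zero σ hp
  rw [map_mul, eval_X, map_sum] at key
  simp only [map_mul, eval_rename_inl, eval_X] at key
  rw [hcu] at key
  simp only [hG, mul_assoc] at key
  rw [← Finset.mul_sum, hsum _ fun i => c (Sum.inr i)] at key
  have key' := (mul_eq_zero.1 ((mul_eq_zero.1 key).resolve_left h0)).resolve_left
    (pow_ne_zero D h0)
  exact sub_eq_zero.1 key'

/-- Along the normal curve `f` equals `t * Y`, so for general `t` the vector `Y` gives the graph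
point, and at `t = 0` it is the value of `normalMap`. -/
theorem IsNormalPresentation.mem_blowup [Infinite K] (h : IsNormalPresentation f σ A B)
    (hf : IsBlowupSystem d f)
    (u : Fin 2 × Fin 2 → K) (w : Fin 4 × Fin 2 → K) (hw : normalMap B u w ≠ 0) :
    (chartNet σ (Sum.elim u 0), Projectivization.mk K (normalMap B u w) hw) ∈ blowup f := by
  refine ⟨chartNet_mem_detNets _ _, fun G hG c hc => ?_⟩
  have hcu := eq_smul_chartPlucker σ hc.1
  obtain ⟨hne, hcw⟩ := hc.2
  obtain ⟨b, hb⟩ := (Projectivization.mk_eq_mk_iff' K _ _ hne hw).1 hcw.symm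
  set a := c (Sum.inl (baseIdx σ))
  have ha : a ≠ 0 := baseIdx_ne_zero σ hc.1
  have hb0 : b ≠ 0 := by
    rintro rfl
    rw [zero_smul] at hb
    exact hne hb.symm
  obtain ⟨i, hi⟩ := Function.ne_iff.1 hw
  let V := normalCurve u w
  let Y : Fin m → Polynomial K := fun i => ∑ k, aeval V (B i k) * Polynomial.C (w k)
  let cc : PIdx ⊕ Fin m → Polynomial K := Sum.elim
    (fun s => Polynomial.C a * chartPlucker σ V s) (fun i => Polynomial.C b * Y i)
  have hV : ∀ (t : K) (F : MvPolynomial Par K),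
      (aeval V F).eval t = eval (Sum.elim u (t • w)) F := by
    intro t F
    rw [← eval_normalCurve u w t]
    induction F using MvPolynomial.induction_on with
    | C a => simp
    | add p q hp hq => simp_all
    | mul_X p i hp => simp_all [V]
  have hY : ∀ t i, (Y i).eval t = ∑ k, eval (Sum.elim u (t • w)) (B i k) * w k := by
    intro t i
    simp only [Y, Polynomial.eval_finsetSum, Polynomial.eval_mul, Polynomial.eval_C, hV]
  have hfY : ∀ t i, eval (chartPlucker σ (Sum.elim u (t • w))) (f i) = t * (Y i).eval t := by
    intro t i
    rw [h.forms_eq, hY, Finset.mul_sum]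
    refine Finset.sum_congr rfl fun k _ => ?_
    simp
    ring
  have hcc : ∀ t, (fun k => (cc k).eval t) = Sum.elim
      (fun s => a * chartPlucker σ (Sum.elim u (t • w)) s) (fun i => b * (Y i).eval t) := by
    intro t
    ext k
    rcases k with s | i
    · simp only [cc, Sum.elim_inl, Polynomial.eval_mul, Polynomial.eval_C]
      rw [← Polynomial.coe_evalRingHom, map_chartPlucker]
      simp only [Polynomial.coe_evalRingHom, V, eval_normalCurve]
    · simp [cc]
  have hY0 : ∀ i, (Y i).eval 0 = normalMap B u w i := fun i => by
    rw [hY, zero_smul, normalMap_apply]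
  -- The excluded parameters are `t = 0` and the zeros of a component of `Y` that is nonzero at the
  -- limit.
  have hD : Polynomial.X * Y i ≠ 0 := by
    refine mul_ne_zero Polynomial.X_ne_zero fun h0 => hi ?_
    rw [← hY0, h0, Polynomial.eval_zero, Pi.zero_apply]
  have key := eval_eq_zero_of_curve G cc hD (fun t ht => by
    rw [Polynomial.eval_mul, Polynomial.eval_X] at ht
    have ht0 : t ≠ 0 := left_ne_zero_of_mul ht
    have hne1 : (fun i => eval (chartPlucker σ (Sum.elim u (t • w))) (f i)) ≠ 0 := fun h0 =>
      ht (by rw [← hfY]; exact congrFun h0 i)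
    have hne2 : (fun i => b * (Y i).eval t) ≠ 0 := fun h0 =>
      mul_ne_zero hb0 (right_ne_zero_of_mul ht) (congrFun h0 i)
    rw [hcc]
    refine hG (chartNet σ (Sum.elim u (t • w)), Projectivization.mk K _ hne1)
      ⟨chartNet_mem_detNets _ _, ?_, _, isPlucker_chartNet _ _, hne1, rfl⟩ _ ⟨?_, hne2, ?_⟩
    · exact fun hsq => hne1 (funext fun i =>
        hf.vanishes i _ ⟨_, hsq, isPlucker_chartNet σ _⟩)
    · exact isPlucker_smul (isPlucker_chartNet _ _) ha
    · refine (Projectivization.mk_eq_mk_iff' K _ _ _ _).2 ⟨t * b⁻¹, ?_⟩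
      ext j
      simp only [Pi.smul_apply, smul_eq_mul, hfY, Sum.elim_inr]
      field_simp) 0
  rw [hcc] at key
  rw [← key]
  congr 2
  ext k
  rcases k with s | j
  · rw [zero_smul]
    exact congrFun hcu s
  · rw [Sum.elim_inr, hY0]
    exact (congrFun hb j).symm

theorem sum_mul_X_eq_normalForm (σ : Equiv.Perm (Fin 4)) (u : Fin 2 × Fin 2 → K)
    (w : Fin 4 × Fin 2 → K) (F : Fin 4 → Poly K) :
    ∑ k, C (w k) * (X (σ (Fin.natAdd 2 k.2)) * F k.1) =
      ∑ k, normalForm σ (Sum.elim u w) k * F k := by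
  rw [Fintype.sum_prod_type]
  refine Finset.sum_congr rfl fun k _ => ?_
  simp [normalForm, linForm_apply]
  ring

/-- The division by `t` is done by replacing the normal parameters in `∑ P k * R k` with `A` applied
to the last coordinates. On the graph these are a multiple of `w`, which gives a multiple of `q₀ q₂
- q₁²`; at the limit point they are `w` itself by `left_inverse`. -/
theorem IsNormalPresentation.normalQuartic_mem_limitBundle [Infinite K]
    (h : IsNormalPresentation f σ A B) (hf : IsBlowupSystem d f)
    (u : Fin 2 × Fin 2 → K) (w : Fin 4 × Fin 2 → K) (hw : normalMap B u w ≠ 0) :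
    normalQuartic σ u w ∈ limitBundle f
      (chartNet σ (Sum.elim u 0), Projectivization.mk K (normalMap B u w) hw) := by
  let T : (Fin 4 × Fin 2) × Fin m → MvPolynomial (Fin 4) (MvPolynomial Par K) := fun k =>
    C (A k.1 k.2) * (X (σ (Fin.natAdd 2 k.1.2)) *
      cubic σ (X : Par → MvPolynomial Par K) k.1.1)
  obtain ⟨D, hD⟩ := exists_common_bound fun k : (Fin 4 × Fin 2) × Fin m =>
    exists_homogeneous_lift_form σ (T k)
  choose T' hT' using hD
  let ι : MvPolynomial PIdx K →+* MvPolynomial (PIdx ⊕ Fin m) K :=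
    (rename Sum.inl : MvPolynomial PIdx K →ₐ[K] MvPolynomial (PIdx ⊕ Fin m) K)
  -- The extra base coordinate makes `s` vanish at graph points outside the chart.
  let s : MvPolynomial (Fin 4) (MvPolynomial (PIdx ⊕ Fin m) K) :=
    C (X (Sum.inl (baseIdx σ))) * ∑ k, MvPolynomial.map ι (T' k) *
      C (X (Sum.inr k.2))
  have hs : ∀ (c : PIdx ⊕ Fin m → K) (v : Par → K),
      (fun s : PIdx => c (Sum.inl s)) = c (Sum.inl (baseIdx σ)) • chartPlucker σ v →
      MvPolynomial.map (eval c) s = C (c (Sum.inl (baseIdx σ)) ^ (D + 1)) *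
        ∑ k : Fin 4 × Fin 2, (C (∑ i, eval v (A k i) * c (Sum.inr i)) : Poly K) *
          (X (σ (Fin.natAdd 2 k.2)) * cubic σ v k.1) := by
    intro c v hv
    have h1 : ∀ k, MvPolynomial.map (eval c) (MvPolynomial.map ι (T' k)) =
        C (c (Sum.inl (baseIdx σ)) ^ D) * MvPolynomial.map (eval v) (T k) := by
      intro k
      rw [map_map, ← hT', ← hv]
      have h2 : (eval c).comp ι = eval fun s => c (Sum.inl s) :=
        RingHom.ext fun G => eval_rename_inl c G
      rw [h2]
    simp only [s, map_mul, map_sum, map_C, eval_X, h1, T, map_X, map_cubic, pow_succ]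
    rw [Fintype.sum_prod_type, Finset.mul_sum, Finset.mul_sum]
    refine Finset.sum_congr rfl fun k _ => ?_
    rw [Finset.sum_mul, Finset.mul_sum, Finset.mul_sum]
    exact Finset.sum_congr rfl fun i _ => by ring
  have hsec : IsSection f s := by
    intro z hz c hc
    by_cases h0 : c (Sum.inl (baseIdx σ)) = 0
    · have : MvPolynomial.map (eval c) s = 0 := by
        simp only [s, map_mul, map_C, eval_X, h0, C_0, zero_mul]
      rw [this]
      exact zero_mem _
    obtain ⟨v, b, hzv, hv, hb⟩ := exists_chart_of_graph hf σ hz hc h0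
    have h1 : ∀ k, ∑ i, eval v (A k i) * c (Sum.inr i) = b * v (Sum.inr k) := fun k => by
      rw [h.param_eq v k, Finset.mul_sum]
      exact Finset.sum_congr rfl fun j _ => by rw [hb]; ring
    have h2 : MvPolynomial.map (eval c) s = (c (Sum.inl (baseIdx σ)) ^ (D + 1) * b) •
        (quads σ v 0 * quads σ v 2 - quads σ v 1 * quads σ v 1) := by
      rw [hs c v hv, ← sq, quads_relation, smul_eq_C_mul, map_mul, mul_assoc]
      congr 1
      have h3 := sum_mul_X_eq_normalForm σ (fun k => v (Sum.inl k)) (fun k => v (Sum.inr k))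
        (cubic σ v)
      have h4 : Sum.elim (fun k => v (Sum.inl k)) (fun k => v (Sum.inr k)) = v := by
        ext k
        rcases k with k | k <;> rfl
      rw [h4] at h3
      rw [← h3, Finset.mul_sum]
      refine Finset.sum_congr rfl fun k _ => ?_
      rw [h1, map_mul, mul_assoc]
    rw [h2, hzv, sq]
    have hq : ∀ i, quads σ v i ∈ chartNet σ v := fun i => Submodule.subset_span ⟨i, rfl⟩
    exact Submodule.smul_mem _ _ (sub_mem (Submodule.mul_mem_mul (hq 0) (hq 2))
      (Submodule.mul_mem_mul (hq 1) (hq 1)))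
  let c : PIdx ⊕ Fin m → K := Sum.elim (chartPlucker σ (Sum.elim u 0)) (normalMap B u w)
  refine Submodule.subset_span ⟨c, ⟨isPlucker_chartNet _ _, hw, rfl⟩, s, hsec, ?_⟩
  rw [hs c (Sum.elim u 0) (by simp [c, chartPlucker_baseIdx])]
  simp only [c, Sum.elim_inl, chartPlucker_baseIdx, one_pow, map_one, one_mul, Sum.elim_inr,
    h.left_inverse u w]
  rw [normalQuartic_apply, sum_mul_X_eq_normalForm σ u]

/-- The right side is contained in the left and already has the maximal dimension six. -/
theorem IsNormalPresentation.limitBundle_eq [Infinite K]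
    (h : IsNormalPresentation f σ A B) (hf : IsBlowupSystem d f)
    (u : Fin 2 × Fin 2 → K) (w : Fin 4 × Fin 2 → K) (hw : normalMap B u w ≠ 0) :
    limitBundle f (chartNet σ (Sum.elim u 0), Projectivization.mk K (normalMap B u w) hw) =
      chartLine σ (Sum.elim u 0) ^ 4 ⊔ Submodule.span K {normalQuartic σ u w} := by
  have hz := h.mem_blowup hf u w hw
  have hw0 : w ≠ 0 := by
    rintro rfl
    exact hw (map_zero _)
  symm
  refine eq_of_le_of_finrank_ge_of_le_forms (sup_le ?_ ?_) (limitBundle_le_forms f hz) ?_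
  · have := sq_le_limitBundle f hz
    have h4 : chartNet σ (Sum.elim u 0) ^ 2 = chartLine σ (Sum.elim u 0) ^ 4 := by
      rw [chartNet_zero, ← pow_mul]
    rwa [h4] at this
  · rw [Submodule.span_singleton_le_iff_mem]
    exact h.normalQuartic_mem_limitBundle hf u w hw
  · rw [finrank_chartLine_pow_four_sup σ u hw0]
    exact finrank_limitBundle_le f hz

end LocalStructure

/-! ### The fibre of the exceptional divisor and its quartic spaces -/

section Fibre

variable {K : Type*} [Field K]

/-- The normal directions at a line, as classes of quartic forms. -/
noncomputable def normalClass (σ : Equiv.Perm (Fin 4)) (u : Fin 2 × Fin 2 → K) :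
    (Fin 4 × Fin 2 → K) →ₗ[K] QuarticQuot (chartLine σ (Sum.elim u 0)) :=
  ((formsOn (chartLine σ (Sum.elim u 0)) 4 4).submoduleOf
    (cubicTimesLinear (chartLine σ (Sum.elim u 0)))).mkQ ∘ₗ
    (normalQuartic σ u).codRestrict _ (normalQuartic_mem σ u)

theorem normalClass_bijective [Infinite K] (σ : Equiv.Perm (Fin 4)) (u : Fin 2 × Fin 2 → K) :
    Function.Bijective (normalClass σ u) := by
  constructor
  · rw [← LinearMap.ker_eq_bot, LinearMap.ker_eq_bot']
    intro w hw
    refine eq_zero_of_normalQuartic_mem σ u ?_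
    rw [← formsOn_self (isLine_chartLine _ _).1]
    exact (Submodule.Quotient.mk_eq_zero ((formsOn (chartLine σ (Sum.elim u 0)) 4 4).submoduleOf
      (cubicTimesLinear (chartLine σ (Sum.elim u 0))))).1 hw
  · intro x
    obtain ⟨y, rfl⟩ := Submodule.mkQ_surjective _ x
    obtain ⟨a, ha, _, ⟨w, rfl⟩, haw⟩ := Submodule.mem_sup.1 (cubicTimesLinear_le σ u y.2)
    refine ⟨w, (Submodule.Quotient.eq _).2 ?_⟩
    change normalQuartic σ u w - y ∈ formsOn _ 4 4
    rw [formsOn_self (isLine_chartLine _ _).1, ← haw, sub_add_cancel_right]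
    exact neg_mem ha

/-- The normal space at a line is the space of classes of quartic forms. -/
noncomputable def normalEquiv [Infinite K] (σ : Equiv.Perm (Fin 4)) (u : Fin 2 × Fin 2 → K) :
    (Fin 4 × Fin 2 → K) ≃ₗ[K] QuarticQuot (chartLine σ (Sum.elim u 0)) :=
  LinearEquiv.ofBijective _ (normalClass_bijective σ u)

theorem quarticSpace_normalEquiv [Infinite K] (σ : Equiv.Perm (Fin 4)) (u : Fin 2 × Fin 2 → K)
    (w : Fin 4 × Fin 2 → K) (hw : normalEquiv σ u w ≠ 0) :
    quarticSpace (chartLine σ (Sum.elim u 0)) (Projectivization.mk K (normalEquiv σ u w) hw) =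
      chartLine σ (Sum.elim u 0) ^ 4 ⊔ Submodule.span K {normalQuartic σ u w} := by
  rw [← formsOn_self (isLine_chartLine _ _).1]
  exact quarticSpace_mk _ ⟨normalQuartic σ u w, normalQuartic_mem σ u w⟩ hw

/-- If the limit quartic of `w` lies in the space of `w'`, then that of `w - t • w'` lies in `Λ⁴`
for some `t`, so `w = t • w'`. -/
theorem quarticSpace_injective [Infinite K] (σ : Equiv.Perm (Fin 4)) (u : Fin 2 × Fin 2 → K) :
    Function.Injective (quarticSpace (chartLine σ (Sum.elim u 0))) := by
  intro ℓ ℓ' h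
  induction ℓ using Projectivization.ind with
  | h x hx =>
  induction ℓ' using Projectivization.ind with
  | h x' hx' =>
  obtain ⟨w, rfl⟩ := (normalEquiv σ u).surjective x
  obtain ⟨w', rfl⟩ := (normalEquiv σ u).surjective x'
  rw [quarticSpace_normalEquiv, quarticSpace_normalEquiv] at h
  have hmem : normalQuartic σ u w ∈
      chartLine σ (Sum.elim u 0) ^ 4 ⊔ Submodule.span K {normalQuartic σ u w'} := by
    rw [← h]
    exact Submodule.mem_sup_right (Submodule.mem_span_singleton_self _)
  obtain ⟨a, ha, _, hb, hab⟩ := Submodule.mem_sup.1 hmem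
  obtain ⟨t, rfl⟩ := Submodule.mem_span_singleton.1 hb
  refine (Projectivization.mk_eq_mk_iff' K _ _ _ _).2 ⟨t, ?_⟩
  have h0 : w - t • w' = 0 := eq_zero_of_normalQuartic_mem σ u (by
    rw [map_sub, map_smul, ← hab, add_sub_cancel_right]
    exact ha)
  rw [← map_smul, sub_eq_zero.1 h0]

variable {m d : ℕ} {f : Fin m → MvPolynomial PIdx K} {σ : Equiv.Perm (Fin 4)}
  {A : Fin 4 × Fin 2 → Fin m → MvPolynomial Par K}
  {B : Fin m → Fin 4 × Fin 2 → MvPolynomial Par K}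

theorem IsNormalPresentation.exists_of_mem_blowup (h : IsNormalPresentation f σ A B)
    (hf : IsBlowupSystem d f) {u : Fin 2 × Fin 2 → K} {y : ℙ K (Fin m → K)}
    (hz : (chartNet σ (Sum.elim u 0), y) ∈ blowup f) :
    ∃ (w : Fin 4 × Fin 2 → K) (hw : normalMap B u w ≠ 0),
      y = Projectivization.mk K (normalMap B u w) hw := by
  obtain ⟨c, hc⟩ := exists_isCoord hz.1
  have h1 := h.mem_range hf hz rfl hc
  obtain ⟨hne, hy⟩ := hc.2
  refine ⟨_, h1 ▸ hne, ?_⟩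
  simp only [← h1]
  exact hy

theorem finrank_limitBundle_of_squareNet [Infinite K] (hf : IsBlowupSystem d f) {z : Pt K m}
    (hz : z ∈ blowup f) (hz' : z.1 ∈ squareNets K) : 6 ≤ finrank K (limitBundle f z) := by
  obtain ⟨Λ, hΛ, hzΛ⟩ := hz'
  obtain ⟨σ, u, rfl⟩ := exists_chartLine hΛ
  rw [← chartNet_zero] at hzΛ
  obtain ⟨π, y⟩ := z
  obtain rfl : π = _ := hzΛ
  obtain ⟨A, B, h⟩ := hf.exists_normalPresentation σ
  obtain ⟨w, hw, rfl⟩ := h.exists_of_mem_blowup hf hz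
  rw [h.limitBundle_eq hf, finrank_chartLine_pow_four_sup]
  rintro rfl
  exact hw (map_zero _)

end Fibre

end DetNets

theorem mainTheorem7 {K : Type*} [Field K] [IsAlgClosed K] [CharZero K] {m d : ℕ}
    (f : Fin m → MvPolynomial DetNets.PIdx K) (hf : DetNets.IsBlowupSystem d f) :
    (∃! Q : DetNets.blowup f → Submodule K (DetNets.Poly K), DetNets.IsQuarticBundle f Q) ∧
    ∀ Q : DetNets.blowup f → Submodule K (DetNets.Poly K), DetNets.IsQuarticBundle f Q →
      ∀ Λ : Submodule K (DetNets.Poly K), DetNets.IsLine Λ →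
        (∀ z : DetNets.blowup f, z.1 ∈ DetNets.exceptionalDivisor f → z.1.1 = Λ ^ 2 →
          ∃! ℓ : ℙ K (DetNets.QuarticQuot Λ), Q z = DetNets.quarticSpace Λ ℓ) ∧
        ∃ (ψ : DetNets.QuarticQuot Λ →ₗ[K] (Fin m → K)) (hψ : Function.Injective ψ),
          {y : ℙ K (Fin m → K) | (Λ ^ 2, y) ∈ DetNets.exceptionalDivisor f} =
            Set.range (Projectivization.map ψ hψ) ∧
          ∀ (z : DetNets.blowup f) (ℓ : ℙ K (DetNets.QuarticQuot Λ)),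
            z.1 = (Λ ^ 2, Projectivization.map ψ hψ ℓ) → Q z = DetNets.quarticSpace Λ ℓ := by
  have hQ₀ := DetNets.isQuarticBundle_limitBundle
    fun z hz hz' => DetNets.finrank_limitBundle_of_squareNet hf hz hz'
  refine ⟨⟨_, hQ₀, fun Q hQ => hQ₀.unique hQ⟩, fun Q hQ Λ hΛ => ?_⟩
  obtain rfl := hQ₀.unique hQ
  obtain ⟨σ, u, rfl⟩ := DetNets.exists_chartLine hΛ
  obtain ⟨A, B, h⟩ := hf.exists_normalPresentation σ
  simp only [← DetNets.chartNet_zero]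
  have hfib : ∀ (w : Fin 4 × Fin 2 → K) (hw : DetNets.normalMap B u w ≠ 0)
      (hw' : DetNets.normalEquiv σ u w ≠ 0),
      DetNets.limitBundle f (DetNets.chartNet σ (Sum.elim u 0),
        Projectivization.mk K (DetNets.normalMap B u w) hw) =
      DetNets.quarticSpace (DetNets.chartLine σ (Sum.elim u 0))
        (Projectivization.mk K (DetNets.normalEquiv σ u w) hw') := fun w hw hw' => by
    rw [h.limitBundle_eq hf, DetNets.quarticSpace_normalEquiv]
  refine ⟨fun z hz hzu => ?_, ?_⟩
  · obtain ⟨⟨π, y⟩, hzb⟩ := z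
    obtain rfl : π = _ := hzu
    obtain ⟨w, hw, rfl⟩ := h.exists_of_mem_blowup hf hzb
    have hw' : DetNets.normalEquiv σ u w ≠ 0 := by
      rw [Ne, LinearEquiv.map_eq_zero_iff]
      rintro rfl
      exact hw (map_zero _)
    refine ⟨_, hfib w hw hw', fun ℓ hℓ => ?_⟩
    exact DetNets.quarticSpace_injective σ u (hℓ.symm.trans (hfib w hw hw'))
  -- `ψ` sends a quartic class to its normal direction and then to the derivative of `f` in that
  -- direction.
  · have hψ : Function.Injective
        (DetNets.normalMap B u ∘ₗ (DetNets.normalEquiv σ u).symm.toLinearMap) :=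
      (h.injective u).comp (DetNets.normalEquiv σ u).symm.injective
    have hmap : ∀ (w : Fin 4 × Fin 2 → K) (hw : DetNets.normalMap B u w ≠ 0)
        (hw' : DetNets.normalEquiv σ u w ≠ 0), Projectivization.map _ hψ
          (Projectivization.mk K (DetNets.normalEquiv σ u w) hw') =
        Projectivization.mk K (DetNets.normalMap B u w) hw := fun w hw hw' => by
      simp [Projectivization.map_mk]
    have hrep : ∀ ℓ : ℙ K (DetNets.QuarticQuot (DetNets.chartLine σ (Sum.elim u 0))),
        ∃ (w : Fin 4 × Fin 2 → K) (_ : DetNets.normalMap B u w ≠ 0)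
          (hw' : DetNets.normalEquiv σ u w ≠ 0), ℓ = Projectivization.mk K _ hw' := by
      intro ℓ
      induction ℓ using Projectivization.ind with
      | h x hx =>
      obtain ⟨w, rfl⟩ := (DetNets.normalEquiv σ u).surjective x
      refine ⟨w, fun h0 => hx ?_, hx, rfl⟩
      rw [h.injective u (h0.trans (map_zero _).symm), map_zero]
    refine ⟨_, hψ, ?_, fun z ℓ hz => ?_⟩
    · ext y
      constructor
      · rintro ⟨hy, -⟩
        obtain ⟨w, hw, rfl⟩ := h.exists_of_mem_blowup hf hy
        have hw' : DetNets.normalEquiv σ u w ≠ 0 := by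
          rw [Ne, LinearEquiv.map_eq_zero_iff]
          rintro rfl
          exact hw (map_zero _)
        exact ⟨_, hmap w hw hw'⟩
      · rintro ⟨ℓ, rfl⟩
        obtain ⟨w, hw, hw', rfl⟩ := hrep ℓ
        rw [hmap w hw hw']
        exact ⟨h.mem_blowup hf u w hw, DetNets.chartNet_zero_mem_squareNets σ u⟩
    · obtain ⟨w, hw, hw', rfl⟩ := hrep ℓ
      rw [hmap w hw hw'] at hz
      obtain ⟨z, hzb⟩ := z
      obtain rfl : z = _ := hz
      exact hfib w hw hw'
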